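/- A domain $\mathcal D$ is a disjoint finite union of circles $\mathbb R/\ell\mathbb Z$ ($\ell>0$) and of bounded half-open intervals $[a,b)$. An interval exchange transformation of $\mathcal D$ is a bijection $\mathcal D\to\mathcal D$ that is piecewise isometric (a translation on each piece), orientation preserving, continuous on the right, and has only finitely many discontinuity points. They form a group $\mathrm{IET}(\mathcal D)$ under composition, and $\mathrm{IET}=\mathrm{IET}([0,1))$. Let $\mathcal D=\mathcal C\sqcup\mathcal J$ with $\mathcal C=\mathbb R/2\mathbb Z$ and $\mathcal J=[0,1)$. Let $\theta\in\mathbb R$ be irrational, let $r\in\mathrm{IET}(\mathcal D)$ be the (irrational) rotation $c\mapsto c+\theta$ on $\mathcal C$ and the identity on $\mathcal J$, and let $s\in\mathrm{IET}(\mathcal D)$ be the involution that exchanges the arc $[0,1)\subset\mathcal C$ with $\mathcal J=[0,1)$ by translation and is the identity on the rest of $\mathcal C$. Theorem. There is a bijection $\varphi:\mathcal D\to[0,1)$ such that $g\mapsto \Phi(g)=\varphi g\varphi^{-1}$ is an isomorphism from $\mathrm{IET}(\mathcal D)$ onto $\mathrm{IET}$, and such that the subgroup $F=\langle \Phi(r),\Phi(s)\rangle$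 of $\mathrm{IET}$, generated by two elements, has the following properties: * $F$ contains an isomorphic copy of every finite group; * $F$ contains a free semigroup of rank $2$; * $F$ is not linear, i.e. for no field $K$ and no $n\ge 0$ is there an injective homomorphism $F\to \mathrm{GL}_n(K)$; * $F$ has exponential growth: for every finite generating set $S$ of $F$ there is a constant $c>1$ such that, for every $n\ge 0$, at least $c^n$ elements of $F$ are products of at most $n$ elements of $S\cup S^{-1}$. -/

import Mathlib

universe u v

/-- A domain: a nonempty finite disjoint union of circles `ℝ / lℤ` and of bounded half-open
intervals `[a, b)`. -/
inductive IETDomain : Type where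
  | circle (l : ℝ) (hl : 0 < l) : IETDomain
  | interval (a b : ℝ) (hab : a < b) : IETDomain
  | union (D E : IETDomain) : IETDomain

namespace IETDomain

/-- The underlying set of a domain. -/
def Point : IETDomain → Type
  | circle l _ => AddCircle l
  | interval a b _ => Set.Ico a b
  | union D E => Point D ⊕ Point E

/-- `D.Shift x t y`: the points `x` and `y` lie on the same component of `D`, and `y = x + t`
there. For `0 ≤ t` this says that travelling from `x` a distance `t` in the positive
direction is possible inside `D` and ends in `y`. -/
def Shift : (D : IETDomain) → D.Point → ℝ → D.Point → Prop
  | circle l _, x, t, y => (show AddCircle l from y) = (show AddCircle l from x) + (t : AddCircle l)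
  | interval a b _, x, t, y => (show Set.Ico a b from y).1 = (show Set.Ico a b from x).1 + t
  | union D _, Sum.inl x, t, Sum.inl y => Shift D x t y
  | union _ E, Sum.inr x, t, Sum.inr y => Shift E x t y
  | union _ _, Sum.inl _, _, Sum.inr _ => False
  | union _ _, Sum.inr _, _, Sum.inl _ => False

theorem shift_zero : ∀ (D : IETDomain) (x : D.Point), D.Shift x 0 x
  | circle l _, x => by
      simp only [Shift, AddCircle.coe_zero]
      exact (add_zero (show AddCircle l from x)).symm
  | interval a b _, x => by simp [Shift]
  | union D _, Sum.inl x => shift_zero D x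
  | union _ E, Sum.inr x => shift_zero E x

set_option linter.unusedVariables false in
theorem shift_right_unique : ∀ (D : IETDomain) {x y z : D.Point} {t : ℝ},
    D.Shift x t y → D.Shift x t z → y = z
  | circle l _, x, y, z, t, h, h' => h.trans h'.symm
  | interval a b _, x, y, z, t, h, h' => Subtype.ext (h.trans h'.symm)
  | union D _, Sum.inl x, Sum.inl y, Sum.inl z, t, h, h' =>
      congrArg Sum.inl (shift_right_unique D (t := t) (x := x) h h')
  | union _ E, Sum.inr x, Sum.inr y, Sum.inr z, t, h, h' =>
      congrArg Sum.inr (shift_right_unique E (t := t) (x := x) h h')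
  | union _ _, Sum.inl _, Sum.inr _, _, _, h, _ => h.elim
  | union _ _, Sum.inl _, Sum.inl _, Sum.inr _, _, _, h => h.elim
  | union _ _, Sum.inr _, Sum.inl _, _, _, h, _ => h.elim
  | union _ _, Sum.inr _, Sum.inr _, Sum.inl _, _, _, h => h.elim

theorem shift_neg : ∀ (D : IETDomain) {x y : D.Point} {t : ℝ},
    D.Shift x t y → D.Shift y (-t) x
  | circle l _, x, y, t, h => by
      simp only [Shift] at h ⊢
      rw [h, AddCircle.coe_neg]
      exact (add_neg_cancel_right (show AddCircle l from x) _).symm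
  | interval a b _, x, y, t, h => by
      simp only [Shift] at h ⊢
      rw [h]; simp
  | union D _, Sum.inl x, Sum.inl y, t, h => shift_neg D (x := x) (y := y) (t := t) h
  | union _ E, Sum.inr x, Sum.inr y, t, h => shift_neg E (x := x) (y := y) (t := t) h
  | union _ _, Sum.inl _, Sum.inr _, _, h => h.elim
  | union _ _, Sum.inr _, Sum.inl _, _, h => h.elim

theorem shift_add : ∀ (D : IETDomain) {x y z : D.Point} {s t : ℝ},
    D.Shift x s y → D.Shift y t z → D.Shift x (s + t) z
  | circle l _, x, y, z, s, t, h, h' => by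
      simp only [Shift] at h h' ⊢
      rw [h', h]; exact add_assoc _ _ _
  | interval a b _, x, y, z, s, t, h, h' => by
      simp only [Shift] at h h' ⊢
      rw [h', h]; exact add_assoc _ _ _
  | union D _, Sum.inl x, Sum.inl y, Sum.inl z, s, t, h, h' =>
      shift_add D (x := x) (y := y) (z := z) h h'
  | union _ E, Sum.inr x, Sum.inr y, Sum.inr z, s, t, h, h' =>
      shift_add E (x := x) (y := y) (z := z) h h'
  | union _ _, Sum.inl _, Sum.inr _, _, _, _, h, _ => h.elim
  | union _ _, Sum.inl _, Sum.inl _, Sum.inr _, _, _, _, h => h.elim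
  | union _ _, Sum.inr _, Sum.inl _, _, _, _, h, _ => h.elim
  | union _ _, Sum.inr _, Sum.inr _, Sum.inl _, _, _, _, h => h.elim

theorem exists_shift_of_le : ∀ (D : IETDomain) {x z : D.Point} {s t : ℝ},
    D.Shift x t z → 0 ≤ s → s ≤ t → ∃ y, D.Shift x s y
  | circle l _, x, z, s, t, _, _, _ => ⟨((show AddCircle l from x) + (s : AddCircle l)), rfl⟩
  | interval a b _, x, z, s, t, h, h0, h1 => by
      simp only [Shift] at h
      obtain ⟨x, hx⟩ := x
      obtain ⟨z, hz⟩ := z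
      simp only at h
      exact ⟨⟨x + s, by linarith [hx.1], by linarith [hz.2]⟩, rfl⟩
  | union D _, Sum.inl x, Sum.inl z, s, t, h, h0, h1 =>
      (exists_shift_of_le D (x := x) (z := z) h h0 h1).imp' Sum.inl fun _ h => h
  | union _ E, Sum.inr x, Sum.inr z, s, t, h, h0, h1 =>
      (exists_shift_of_le E (x := x) (z := z) h h0 h1).imp' Sum.inr fun _ h => h
  | union _ _, Sum.inl _, Sum.inr _, _, _, h, _, _ => h.elim
  | union _ _, Sum.inr _, Sum.inl _, _, _, h, _, _ => h.elim

theorem exists_shift_pos : ∀ (D : IETDomain) (x : D.Point), ∃ ε > 0, ∃ y, D.Shift x ε y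
  | circle l _, x => ⟨1, one_pos, ((show AddCircle l from x) + ((1 : ℝ) : AddCircle l)), rfl⟩
  | interval a b _, x => by
      obtain ⟨x, hx⟩ := x
      exact ⟨(b - x) / 2, by linarith [hx.2],
        ⟨x + (b - x) / 2, by linarith [hx.1, hx.2], by linarith [hx.2]⟩, rfl⟩
  | union D _, Sum.inl x => by
      obtain ⟨ε, h, y, hy⟩ := exists_shift_pos D x
      exact ⟨ε, h, Sum.inl y, hy⟩
  | union _ E, Sum.inr x => by
      obtain ⟨ε, h, y, hy⟩ := exists_shift_pos E x
      exact ⟨ε, h, Sum.inr y, hy⟩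

theorem exists_finite_left_ends : ∀ (D : IETDomain), ∃ L : Set D.Point, L.Finite ∧
    ∀ x, x ∉ L → ∃ ε > 0, ∃ y, D.Shift y ε x
  | circle l _ => ⟨∅, Set.finite_empty, fun x _ =>
      ⟨1, one_pos, ((show AddCircle l from x) - ((1 : ℝ) : AddCircle l)),
        (sub_add_cancel (show AddCircle l from x) _).symm⟩⟩
  | interval a b hab => ⟨{(⟨a, le_refl a, hab⟩ : Set.Ico a b)}, Set.finite_singleton _, fun x hx => by
      obtain ⟨x, hx'⟩ := x
      have hne : x ≠ a := fun h => hx (by subst h; rfl)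
      have : a < x := lt_of_le_of_ne hx'.1 (Ne.symm hne)
      exact ⟨x - a, by linarith, ⟨a, le_refl a, hab⟩, by simp [Shift]⟩⟩
  | union D E => by
      obtain ⟨L, hL, h⟩ := exists_finite_left_ends D
      obtain ⟨M, hM, h'⟩ := exists_finite_left_ends E
      refine ⟨Sum.inl '' L ∪ Sum.inr '' M, (hL.image _).union (hM.image _), ?_⟩
      rintro (x | x) hx
      · obtain ⟨ε, hε, y, hy⟩ := h x fun hx' => hx (Or.inl ⟨x, hx', rfl⟩)
        exact ⟨ε, hε, Sum.inl y, hy⟩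
      · obtain ⟨ε, hε, y, hy⟩ := h' x fun hx' => hx (Or.inr ⟨x, hx', rfl⟩)
        exact ⟨ε, hε, Sum.inr y, hy⟩

theorem exists_no_shift : ∀ (D : IETDomain) (x y : D.Point), ∃ ε > 0, ∀ s, 0 < s → s < ε →
    ¬ D.Shift x s y
  | circle l hl, x, y => by
      by_cases h : ∃ s, 0 < s ∧ s < l ∧ (circle l hl).Shift x s y
      · obtain ⟨s, hs, hsl, h⟩ := h
        refine ⟨s, hs, fun r hr hrs h' => ?_⟩
        simp only [Shift] at h h'
        have h1 : ((s - r : ℝ) : AddCircle l) = 0 := by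
          rw [h] at h'
          exact sub_eq_zero.2 (add_left_cancel h')
        have h2 := (AddCircle.coe_eq_zero_iff_of_mem_Ico (p := l) (hp := ⟨hl⟩) (a := s - r)
          ⟨by linarith, by linarith⟩).1 h1
        linarith
      · push Not at h
        exact ⟨l, hl, h⟩
  | interval a b _, x, y => by
      by_cases h : 0 < y.1 - x.1
      · exact ⟨y.1 - x.1, h, fun s _ hs h' => by simp only [Shift] at h'; linarith⟩
      · exact ⟨1, one_pos, fun s hs _ h' => by simp only [Shift] at h'; linarith⟩
  | union D _, Sum.inl x, Sum.inl y => exists_no_shift D x y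
  | union _ E, Sum.inr x, Sum.inr y => exists_no_shift E x y
  | union _ _, Sum.inl _, Sum.inr _ => ⟨1, one_pos, fun _ _ _ h => h⟩
  | union _ _, Sum.inr _, Sum.inl _ => ⟨1, one_pos, fun _ _ _ h => h⟩

/-- Near any point, a finite set is met neither on the open right side nor on the open left side. -/
theorem exists_avoid (D : IETDomain) {B : Set D.Point} (hB : B.Finite) (x : D.Point) :
    ∃ ε > 0, ∀ b ∈ B, ∀ s, 0 < s → s < ε → ¬ D.Shift x s b ∧ ¬ D.Shift b s x := by
  induction B, hB using Set.Finite.induction_on with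
  | empty => exact ⟨1, one_pos, fun b hb => hb.elim⟩
  | @insert a B _ _ ih =>
    obtain ⟨ε, hε, h⟩ := ih
    obtain ⟨ε₁, hε₁, h₁⟩ := exists_no_shift D x a
    obtain ⟨ε₂, hε₂, h₂⟩ := exists_no_shift D a x
    refine ⟨min ε (min ε₁ ε₂), lt_min hε (lt_min hε₁ hε₂), ?_⟩
    rintro b (rfl | hb) s hs hs'
    · exact ⟨h₁ s hs (by grind), h₂ s hs (by grind)⟩
    · exact h b hb s hs (by grind)

end IETDomain

/-- A map `f : D → E` between domains is an interval exchange transformation if it is bijective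
and there is a finite set `B` of points of `D` (containing the discontinuities) such that `f` is
an orientation preserving isometry, that is a translation, along every positively
oriented path from `x` to `x + t` in `D` none of whose points, except possibly the starting
point `x`, lies in `B`. In particular `f` is continuous on the right everywhere. -/
def IsIET (D E : IETDomain) (f : D.Point → E.Point) : Prop :=
  Function.Bijective f ∧ ∃ B : Set D.Point, B.Finite ∧
    ∀ (x y : D.Point) (t : ℝ), 0 ≤ t → D.Shift x t y →
      (∀ (s : ℝ) (z : D.Point), 0 < s → s ≤ t → D.Shift x s z → z ∉ B) →
      E.Shift (f x) t (f y)

theorem IsIET.id (D : IETDomain) : IsIET D D id :=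
  ⟨Function.bijective_id, ∅, Set.finite_empty, fun _ _ _ _ h _ => h⟩

theorem IsIET.comp {D E F : IETDomain} {g : E.Point → F.Point} {f : D.Point → E.Point}
    (hg : IsIET E F g) (hf : IsIET D E f) : IsIET D F (g ∘ f) := by
  obtain ⟨hgb, B, hB, hg⟩ := hg
  obtain ⟨hfb, A, hA, hf⟩ := hf
  refine ⟨hgb.comp hfb, A ∪ f ⁻¹' B, hA.union (hB.preimage hfb.1.injOn), ?_⟩
  intro x y t ht hxy hav
  refine hg _ _ t ht (hf x y t ht hxy fun s z h0 h1 h => fun hz => hav s z h0 h1 h (Or.inl hz)) ?_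
  intro s w h0 h1 hw hwB
  obtain ⟨z, hz⟩ := D.exists_shift_of_le hxy h0.le h1
  have h2 := hf x z s h0.le hz
    fun r v hr0 hr1 h hv => hav r v hr0 (hr1.trans h1) h (Or.inl hv)
  have h3 := E.shift_right_unique hw h2
  exact hav s z h0 h1 hz (Or.inr (show f z ∈ B from h3 ▸ hwB))

theorem IsIET.symm {D E : IETDomain} (f : D.Point ≃ E.Point) (hf : IsIET D E f) :
    IsIET E D f.symm := by
  obtain ⟨-, B, hB, hf⟩ := hf
  obtain ⟨L, hL, hL'⟩ := D.exists_finite_left_ends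
  refine ⟨f.symm.bijective, f '' (B ∪ L), (hB.union hL).image f, ?_⟩
  intro y w t ht hyw hav
  set P : ℝ → Prop := fun s => 0 ≤ s ∧ s ≤ t ∧ ∀ v, E.Shift y s v → D.Shift (f.symm y) s (f.symm v)
    with hP
  -- local translation to the right of a point
  have hright : ∀ x : D.Point, ∃ ε > 0, ∀ e, 0 ≤ e → e ≤ ε →
      ∃ z, D.Shift x e z ∧ E.Shift (f x) e (f z) := by
    intro x
    obtain ⟨ε₁, h1, z, hz⟩ := D.exists_shift_pos x
    obtain ⟨ε₂, h2, h2'⟩ := D.exists_avoid hB x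
    refine ⟨min ε₁ (ε₂ / 2), lt_min h1 (by linarith), fun e he he' => ?_⟩
    obtain ⟨v, hv⟩ := D.exists_shift_of_le hz he (he'.trans (min_le_left _ _))
    refine ⟨v, hv, hf x v e he hv fun s u hs hs' hu huB => (h2' u huB s hs ?_).1 hu⟩
    have := min_le_right ε₁ (ε₂ / 2)
    linarith
  have hleft : ∀ x : D.Point, x ∉ B ∪ L → ∃ ε > 0, ∀ e, 0 ≤ e → e ≤ ε →
      ∃ z, D.Shift z e x ∧ E.Shift (f z) e (f x) := by
    intro x hx
    obtain ⟨ε₁, h1, z, hz⟩ := hL' x fun h => hx (Or.inr h)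
    obtain ⟨ε₂, h2, h2'⟩ := D.exists_avoid hB x
    refine ⟨min ε₁ (ε₂ / 2), lt_min h1 (by linarith), fun e he he' => ?_⟩
    have he1 := he'.trans (min_le_left _ _)
    have he2 := he'.trans (min_le_right _ _)
    obtain ⟨v, hv⟩ := D.exists_shift_of_le (s := ε₁ - e) hz (by linarith) (by linarith)
    have hvx : D.Shift v e x := by
      have := D.shift_add (D.shift_neg hv) hz
      rwa [show -(ε₁ - e) + ε₁ = e by ring] at this
    refine ⟨v, hvx, hf v x e he hvx fun s u hs hs' hu huB => ?_⟩
    have hux : D.Shift u (e - s) x := by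
      have := D.shift_add (D.shift_neg hu) hvx
      rwa [show -s + e = e - s by ring] at this
    rcases eq_or_lt_of_le hs' with rfl | hlt
    · rw [D.shift_right_unique hu hvx] at huB
      exact hx (Or.inl huB)
    · exact (h2' u huB (e - s) (by linarith) (by linarith)).2 hux
  have h0 : P 0 := ⟨le_rfl, ht, fun v hv => by
    rw [← E.shift_right_unique (E.shift_zero y) hv]; exact D.shift_zero _⟩
  have hbdd : BddAbove {s | P s} := ⟨t, fun s hs => hs.2.1⟩
  set m := sSup {s | P s} with hm
  have hm0 : 0 ≤ m := le_csSup hbdd h0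
  have hmt : m ≤ t := csSup_le ⟨0, h0⟩ fun s hs => hs.2.1
  obtain ⟨v, hv⟩ := E.exists_shift_of_le hyw hm0 hmt
  have hPm : P m := by
    rcases eq_or_lt_of_le hm0 with h | hpos
    · rw [← h]; exact h0
    have hvn : f.symm v ∉ B ∪ L := fun h =>
      hav m v hpos hmt hv ⟨f.symm v, h, f.apply_symm_apply v⟩
    obtain ⟨ε, hε, h⟩ := hleft _ hvn
    obtain ⟨s, hs, hsm⟩ := exists_lt_of_lt_csSup ⟨0, h0⟩ (show m - ε < sSup {s | P s} by linarith)
    have hsm' : s ≤ m := le_csSup hbdd hs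
    obtain ⟨z, hz, hz'⟩ := h (m - s) (by linarith) (by linarith)
    rw [f.apply_symm_apply] at hz'
    have h4 : E.Shift y s (f z) := by
      have := E.shift_add hv (E.shift_neg hz')
      rwa [show m + -(m - s) = s by ring] at this
    have h5 := hs.2.2 _ h4
    rw [f.symm_apply_apply] at h5
    refine ⟨hm0, hmt, fun v' hv' => ?_⟩
    rw [E.shift_right_unique hv' hv]
    have := D.shift_add h5 hz
    rwa [show s + (m - s) = m by ring] at this
  rcases eq_or_lt_of_le hmt with h | hlt
  · rw [h] at hPm
    exact hPm.2.2 _ hyw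
  exfalso
  obtain ⟨ε, hε, h⟩ := hright (f.symm v)
  obtain ⟨z, hz, hz'⟩ := h (min ε (t - m)) (le_min hε.le (by linarith)) (min_le_left _ _)
  rw [f.apply_symm_apply] at hz'
  have hpos : 0 < min ε (t - m) := lt_min hε (by linarith)
  have : P (m + min ε (t - m)) := by
    refine ⟨by linarith, by linarith [min_le_right ε (t - m)], fun u hu => ?_⟩
    rw [← E.shift_right_unique (E.shift_add hv hz') hu, f.symm_apply_apply]
    exact D.shift_add (hPm.2.2 v hv) hz
  have := le_csSup hbdd this
  linarith

/-- The group of interval exchange transformations of a domain `D`, as a group of permutations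
of `D`. -/
def IET (D : IETDomain) : Subgroup (Equiv.Perm D.Point) where
  carrier := {f | IsIET D D f}
  mul_mem' {f g} hf hg := IsIET.comp (f := g) (g := f) hf hg
  one_mem' := IsIET.id D
  inv_mem' {f} hf := IsIET.symm f hf

/-- The interval `[0, 1)`. -/
abbrev unitIntervalDomain : IETDomain := .interval 0 1 zero_lt_one

/-- The disjoint union of the circle `ℝ / 2ℤ` and of the interval `[0, 1)`. -/
abbrev circleIntervalDomain : IETDomain := .union (.circle 2 two_pos) unitIntervalDomain

namespace circleIntervalDomain

/-- A point of the circle `ℝ / 2ℤ`, as a point of the domain. -/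
def onCircle (c : AddCircle (2 : ℝ)) : circleIntervalDomain.Point := Sum.inl c

/-- A point of the interval `[0, 1)`, as a point of the domain. -/
def onInterval (x : Set.Ico (0 : ℝ) 1) : circleIntervalDomain.Point := Sum.inr x

theorem cases {p : circleIntervalDomain.Point → Prop} (h : ∀ c, p (onCircle c))
    (h' : ∀ x, p (onInterval x)) : ∀ x, p x
  | Sum.inl c => h c
  | Sum.inr x => h' x

/-- The rotation `c ↦ c + θ` of the circle `ℝ / 2ℤ`, extended by the identity on `[0, 1)`.
On the circle of length `2` it is an irrational rotation if and only if `θ` is irrational. -/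
def rotation (θ : ℝ) : IET circleIntervalDomain where
  val := show Equiv.Perm (AddCircle (2 : ℝ) ⊕ Set.Ico (0 : ℝ) 1) from
    Equiv.sumCongr (Equiv.addRight (θ : AddCircle (2 : ℝ))) (Equiv.refl (Set.Ico (0 : ℝ) 1))
  property := by
    refine ⟨Equiv.bijective _, ∅, Set.finite_empty, ?_⟩
    rintro (x | x) (y | y) t _ h _
    · exact (congrArg (fun c : AddCircle (2 : ℝ) => c + (θ : AddCircle (2 : ℝ))) h).trans 
        (add_right_comm (G := AddCircle (2 : ℝ)) _ _ _)
    · exact h.elim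
    · exact h.elim
    · exact h

instance fact_zero_lt_two : Fact ((0 : ℝ) < 2) := ⟨two_pos⟩

/-- The map exchanging the arc `[0, 1)` of the circle `ℝ / 2ℤ` with the interval `[0, 1)` by
translation, and fixing the other points of the circle. -/
noncomputable def swapFun : circleIntervalDomain.Point → circleIntervalDomain.Point
  | Sum.inl c =>
      if h : (AddCircle.equivIco 2 0 c : ℝ) < 1 then
        onInterval ⟨(AddCircle.equivIco 2 0 c : ℝ), (AddCircle.equivIco 2 0 c).2.1, h⟩
      else onCircle c
  | Sum.inr x => onCircle ((show Set.Ico (0 : ℝ) 1 from x).1 : AddCircle (2 : ℝ))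

theorem equivIco_coe {u : ℝ} (h0 : 0 ≤ u) (h2 : u < 2) :
    (AddCircle.equivIco 2 0 (u : AddCircle (2 : ℝ)) : ℝ) = u := by
  rw [AddCircle.equivIco_coe_eq (p := 2) (a := 0) ⟨h0, by linarith⟩]

theorem swapFun_arc {u : ℝ} (h0 : 0 ≤ u) (h1 : u < 1) :
    swapFun (onCircle (u : AddCircle (2 : ℝ))) = onInterval ⟨u, h0, h1⟩ := by
  have h := equivIco_coe h0 (by linarith)
  simp only [swapFun, onCircle, h]
  exact dif_pos (h.trans_lt h1)

theorem swapFun_outside {u : ℝ} (h1 : 1 ≤ u) (h2 : u < 2) :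
    swapFun (onCircle (u : AddCircle (2 : ℝ))) = onCircle (u : AddCircle (2 : ℝ)) := by
  have h := equivIco_coe (by linarith) h2
  simp only [swapFun, onCircle, h]
  exact dif_neg (h.symm ▸ not_lt.2 h1)

theorem swapFun_interval (x : Set.Ico (0 : ℝ) 1) :
    swapFun (onInterval x) = onCircle (x.1 : AddCircle (2 : ℝ)) := rfl

theorem swapFun_involutive : Function.Involutive swapFun := by
  refine cases (fun c => ?_) fun x => ?_
  · obtain ⟨u, ⟨h0, h2⟩, rfl⟩ := AddCircle.eq_coe_Ico c
    rcases lt_or_ge u 1 with h | h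
    · rw [swapFun_arc h0 h, swapFun_interval]
    · rw [swapFun_outside h h2, swapFun_outside h h2]
  · rw [swapFun_interval, swapFun_arc x.2.1 x.2.2]

/-- The involution exchanging the arc `[0, 1)` of the circle `ℝ / 2ℤ` with the interval `[0, 1)`
by translation, and fixing the other points of the circle. -/
noncomputable def swap : IET circleIntervalDomain where
  val := swapFun_involutive.toPerm
  property := by
    refine ⟨Equiv.bijective _, {onCircle ((0 : ℝ) : AddCircle (2 : ℝ)),
      onCircle ((1 : ℝ) : AddCircle (2 : ℝ))}, by simp, ?_⟩
    simp only [Function.Involutive.coe_toPerm]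
    refine cases (fun c => ?_) fun x => ?_
    · refine cases (fun d => ?_) fun _ _ _ h _ => h.elim
      intro t ht h hav
      obtain ⟨u, ⟨h0, h2⟩, rfl⟩ := AddCircle.eq_coe_Ico c
      obtain rfl : d = ((u + t : ℝ) : AddCircle (2 : ℝ)) := h
      rcases lt_or_ge u 1 with hu | hu
      · have h1 : u + t < 1 := by
          by_contra hc
          refine hav (1 - u) (onCircle ((1 : ℝ) : AddCircle (2 : ℝ))) (by linarith) (by linarith) ?_
            (Or.inr rfl)
          show ((1 : ℝ) : AddCircle (2 : ℝ)) = (u : AddCircle (2 : ℝ)) + ((1 - u : ℝ) : AddCircle (2 : ℝ))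
          rw [← AddCircle.coe_add]
          congr 1
          ring
        rw [swapFun_arc h0 hu, swapFun_arc (by linarith) h1]
        exact (rfl : u + t = u + t)
      · have h1 : u + t < 2 := by
          by_contra hc
          refine hav (2 - u) (onCircle ((0 : ℝ) : AddCircle (2 : ℝ))) (by linarith) (by linarith) ?_
            (Or.inl rfl)
          show ((0 : ℝ) : AddCircle (2 : ℝ)) = (u : AddCircle (2 : ℝ)) + ((2 - u : ℝ) : AddCircle (2 : ℝ))
          rw [← AddCircle.coe_add, show u + (2 - u) = (2 : ℝ) by ring, AddCircle.coe_period,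
            AddCircle.coe_zero]
        rw [swapFun_outside hu h2, swapFun_outside (by linarith) h1]
        exact AddCircle.coe_add (p := (2 : ℝ)) u t
    · refine cases (fun _ _ _ h _ => h.elim) fun y => ?_
      intro t _ h _
      rw [swapFun_interval, swapFun_interval]
      have h' : y.1 = x.1 + t := h
      show (y.1 : AddCircle (2 : ℝ)) = (x.1 : AddCircle (2 : ℝ)) + (t : AddCircle (2 : ℝ))
      rw [h', AddCircle.coe_add]

end circleIntervalDomain

/-- The ball of radius `n` around `1` for the word metric of `S`: the products of at most `n`
elements of `S ∪ S⁻¹`. -/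
def wordBall {G : Type*} [Group G] (S : Set G) (n : ℕ) : Set G :=
  {g | ∃ w : List G, w.length ≤ n ∧ (∀ a ∈ w, a ∈ S ∨ a⁻¹ ∈ S) ∧ w.prod = g}

/-- A group has exponential growth if it is finitely generated and, for each finite
generating set, the number of elements in the ball of radius `n` is at least `c ^ n` for some
constant `c > 1`. -/
def HasExponentialGrowth (G : Type*) [Group G] : Prop :=
  Group.FG G ∧ ∀ S : Set G, S.Finite → Subgroup.closure S = ⊤ →
    ∃ c : ℝ, 1 < c ∧ ∀ n : ℕ, c ^ n ≤ (wordBall S n).ncard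

/-- A group is linear if it embeds into `GL(n, K)` for some field `K` and some `n`. -/
def IsLinearGroup.{w, w'} (G : Type w') [Group G] : Prop :=
  ∃ (K : Type w) (_ : Field K) (n : ℕ) (ρ : G →* Matrix.GeneralLinearGroup (Fin n) K),
    Function.Injective ρ

/-! Write `r` for the rotation and `s` for the swap. Cutting the circle open at `0`, placing the
interval behind it and dividing by three identifies the two groups, so everything can be proved on
the circle and the interval.

Finite groups. Since `θ` is irrational, the powers of `r` include rotations by arbitrarily small
angles `δ > 0`. A short word in `s` and such a rotation is an involution supported on four intervals
of length `δ`: it exchanges `[-δ, 0)` with the initial piece of the interval, and the two arcs on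
either side of `1` (`smallSwap`). Conjugating by rotations moves the arcs but not the piece of the
interval, which every rotation fixes. Hence `n` conjugates act as transpositions sharing one common
letter, each multiplied by a transposition of its own private pair. The first factors generate a
full symmetric group; the second ones only contribute elements of square one. As a three-cycle is a
fourth power of itself, the whole alternating group is realized with trivial second factor
(`sumCongr_one_mem_closure_starPerm`), and every finite group embeds in such a group.

Free semigroup. At `0` the map `s` sends the point into the interval but fixes the circle
immediately to the left. Inverses of positive words in `r` and `sr` carry the point `-θ` along
positions `-mθ` with `m ≥ 1`, which avoid the ends `0` and `1` of the exchanged arc; so they are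
continuous from the left there. Comparing point and left germ at `0` shows that a word starting with
`r` never equals one starting with `sr` (`rotation_mul_ne_swap_mul`).

The rest is formal. Finite subgroups that are large powers of a noncommutative group preclude
linearity by a dimension count on commutants (`not_injective_pi_perm`), and a free semigroup forces
exponential growth. -/

/-! ### Transport to the unit interval -/

/-- A bijection `ψ : D → E` that conjugates interval exchanges into interval exchanges, in both
directions, identifies `IET D` and `IET E`. -/
def IET.congr {D E : IETDomain} (ψ : D.Point ≃ E.Point)
    (h : ∀ f : Equiv.Perm D.Point, f ∈ IET D ↔ ψ.permCongr f ∈ IET E) : IET D ≃* IET E where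
  toFun f := ⟨ψ.permCongr f.1, (h f.1).1 f.2⟩
  invFun g := ⟨ψ.permCongr.symm g.1, (h _).2 ((ψ.permCongr.apply_symm_apply g.1).symm ▸ g.2)⟩
  left_inv f := Subtype.ext (ψ.permCongr.symm_apply_apply f.1)
  right_inv g := Subtype.ext (ψ.permCongr.apply_symm_apply g.1)
  map_mul' f g := by ext x; simp [Equiv.permCongr_apply]

theorem IET.permCongr_mem_iff {D E : IETDomain} (ψ : D.Point ≃ E.Point) (hψ : IsIET D E ψ)
    (f : Equiv.Perm D.Point) : f ∈ IET D ↔ ψ.permCongr f ∈ IET E := by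
  have hψ' := hψ.symm
  constructor
  · intro hf
    exact (hψ.comp (show IsIET D D f from hf)).comp hψ'
  · intro hf
    have := (hψ'.comp (show IsIET E E (ψ.permCongr f) from hf)).comp hψ
    have heq : ⇑ψ.symm ∘ ⇑(ψ.permCongr f) ∘ ⇑ψ = f := by
      funext x; simp [Equiv.permCongr_apply]
    rw [Function.comp_assoc, heq] at this
    exact this

/-- A similarity is in general no interval exchange, but conjugation by it merely rescales path
lengths by `c` and transports the exceptional set. -/
theorem isIET_of_scale {D E : IETDomain} {c : ℝ} (hc : 0 < c) (ψ : D.Point ≃ E.Point)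
    (hψ : ∀ x t y, D.Shift x t y ↔ E.Shift (ψ x) (c * t) (ψ y)) {f : Equiv.Perm D.Point}
    (hf : IsIET D D f) : IsIET E E (ψ.permCongr f) := by
  obtain ⟨-, B, hB, hf⟩ := hf
  refine ⟨Equiv.bijective _, ψ '' B, hB.image ψ, fun x y t ht hxy hav => ?_⟩
  have hψ' : ∀ x t y, E.Shift x t y ↔ D.Shift (ψ.symm x) (c⁻¹ * t) (ψ.symm y) := by
    intro x t y
    rw [hψ, mul_inv_cancel_left₀ hc.ne', ψ.apply_symm_apply, ψ.apply_symm_apply]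
  have := hf (ψ.symm x) (ψ.symm y) (c⁻¹ * t) (by positivity) ((hψ' _ _ _).1 hxy)
    fun s z hs hst hz hzB => hav (c * s) (ψ z) (by positivity)
      (by rwa [← le_inv_mul_iff₀ hc]) (by rw [hψ] at hz; simpa using hz) ⟨z, hzB, rfl⟩
  rw [hψ, mul_inv_cancel_left₀ hc.ne'] at this
  exact this

theorem IET.permCongr_mem_iff_of_scale {D E : IETDomain} {c : ℝ} (hc : 0 < c)
    (ψ : D.Point ≃ E.Point) (hψ : ∀ x t y, D.Shift x t y ↔ E.Shift (ψ x) (c * t) (ψ y))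
    (f : Equiv.Perm D.Point) : f ∈ IET D ↔ ψ.permCongr f ∈ IET E := by
  refine ⟨fun hf => isIET_of_scale hc ψ hψ hf, fun hf => ?_⟩
  have := isIET_of_scale (inv_pos.2 hc) ψ.symm (fun x t y => by
    rw [hψ, mul_inv_cancel_left₀ hc.ne', ψ.apply_symm_apply, ψ.apply_symm_apply])
    (f := ψ.permCongr f) hf
  have heq : ψ.symm.permCongr (ψ.permCongr f) = f := by
    ext x; simp [Equiv.permCongr_apply]
  rwa [heq] at this

/-- The interval `[0, 3)`. -/
abbrev tripleIntervalDomain : IETDomain := .interval 0 3 zero_lt_three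

/-- Division by three, from `[0, 3)` to `[0, 1)`. -/
noncomputable def divThree : tripleIntervalDomain.Point ≃ unitIntervalDomain.Point :=
  show Set.Ico (0 : ℝ) 3 ≃ Set.Ico (0 : ℝ) 1 from
  { toFun x := ⟨3⁻¹ * x.1, by have := x.2.1; positivity, by have := x.2.2; linarith⟩
    invFun x := ⟨3 * x.1, by have := x.2.1; positivity, by have := x.2.2; linarith⟩
    left_inv x := by ext; simp
    right_inv x := by ext; simp }

theorem divThree_shift (x : tripleIntervalDomain.Point) (t : ℝ) (y : tripleIntervalDomain.Point) :
    tripleIntervalDomain.Shift x t y ↔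
      unitIntervalDomain.Shift (divThree x) (3⁻¹ * t) (divThree y) := by
  show y.1 = x.1 + t ↔ 3⁻¹ * y.1 = 3⁻¹ * x.1 + 3⁻¹ * t
  constructor <;> intro h <;> linarith

open circleIntervalDomain in
/-- The circle `ℝ / 2ℤ` cut open to `[0, 2)`, followed by the interval `[0, 1)` put on `[2, 3)`. -/
noncomputable def unroll : circleIntervalDomain.Point ≃ tripleIntervalDomain.Point :=
  show AddCircle (2 : ℝ) ⊕ Set.Ico (0 : ℝ) 1 ≃ Set.Ico (0 : ℝ) 3 from
  { toFun := Sum.elim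
      (fun c => ⟨AddCircle.equivIco 2 0 c, (AddCircle.equivIco 2 0 c).2.1, by
        have := (AddCircle.equivIco 2 0 c).2.2; linarith⟩)
      (fun x => ⟨2 + x.1, by linarith [x.2.1], by linarith [x.2.2]⟩)
    invFun y := if h : y.1 < 2 then Sum.inl (y.1 : AddCircle (2 : ℝ)) else
      Sum.inr ⟨y.1 - 2, by linarith, by linarith [y.2.2]⟩
    left_inv := by
      rintro (c | x)
      · have h : (AddCircle.equivIco 2 0 c : ℝ) < 2 := by
          have := (AddCircle.equivIco 2 0 c).2.2; linarith
        exact (dif_pos h).trans <| congrArg Sum.inl (AddCircle.coe_equivIco (p := (2 : ℝ)) (a := 0))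
      · have : ¬ (2 + x.1 < 2) := by linarith [x.2.1]
        simp [this]
    right_inv := by
      rintro ⟨y, h0, h3⟩
      by_cases h : y < 2
      · simp only [h, dif_pos, Sum.elim_inl]
        exact Subtype.ext (equivIco_coe h0 h)
      · simp [h] }

open circleIntervalDomain in
theorem unroll_onCircle {u : ℝ} (h0 : 0 ≤ u) (h2 : u < 2) :
    unroll (onCircle (u : AddCircle (2 : ℝ))) = (⟨u, h0, by linarith⟩ : Set.Ico (0 : ℝ) 3) :=
  Subtype.ext (equivIco_coe h0 h2)

open circleIntervalDomain in
-- The cut point `0` is the only exceptional point: a positive path that does not enter it stays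
-- inside `[0, 2)`.
theorem isIET_unroll : IsIET circleIntervalDomain tripleIntervalDomain unroll := by
  refine ⟨Equiv.bijective _, {onCircle ((0 : ℝ) : AddCircle (2 : ℝ))}, by simp, ?_⟩
  refine cases (fun c => ?_) fun x => ?_
  · refine cases (fun d => ?_) fun _ _ _ h _ => h.elim
    intro t ht h hav
    obtain ⟨u, ⟨h0, h2⟩, rfl⟩ := AddCircle.eq_coe_Ico c
    obtain rfl : d = ((u + t : ℝ) : AddCircle (2 : ℝ)) := h
    have h1 : u + t < 2 := by
      by_contra hc
      refine hav (2 - u) (onCircle ((0 : ℝ) : AddCircle (2 : ℝ))) (by linarith) (by linarith) ?_ rfl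
      show ((0 : ℝ) : AddCircle (2 : ℝ)) = (u : AddCircle (2 : ℝ)) + ((2 - u : ℝ) : AddCircle (2 : ℝ))
      rw [← AddCircle.coe_add, show u + (2 - u) = (2 : ℝ) by ring, AddCircle.coe_period,
        AddCircle.coe_zero]
    rw [unroll_onCircle h0 h2, unroll_onCircle (by linarith) h1]
    exact (rfl : u + t = u + t)
  · refine cases (fun _ _ _ h _ => h.elim) fun y => ?_
    intro t _ h _
    have h' : y.1 = x.1 + t := h
    show 2 + y.1 = 2 + x.1 + t
    rw [h', add_assoc]

theorem permCongr_unroll_divThree_mem_iff (f : Equiv.Perm circleIntervalDomain.Point) :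
    f ∈ IET circleIntervalDomain ↔
      (unroll.trans divThree).permCongr f ∈ IET unitIntervalDomain := by
  rw [IET.permCongr_mem_iff unroll isIET_unroll,
    IET.permCongr_mem_iff_of_scale (by norm_num) divThree divThree_shift]
  rfl

/-! ### Growth -/

theorem one_mem_wordBall {G : Type*} [Group G] (S : Set G) (n : ℕ) : (1 : G) ∈ wordBall S n :=
  ⟨[], by simp, by simp, rfl⟩

theorem wordBall_mono {G : Type*} [Group G] (S : Set G) {m n : ℕ} (h : m ≤ n) :
    wordBall S m ⊆ wordBall S n := by
  rintro g ⟨w, hw, hS, rfl⟩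
  exact ⟨w, hw.trans h, hS, rfl⟩

theorem mul_mem_wordBall {G : Type*} [Group G] {S : Set G} {m n : ℕ} {g h : G}
    (hg : g ∈ wordBall S m) (hh : h ∈ wordBall S n) : g * h ∈ wordBall S (m + n) := by
  obtain ⟨w, hw, hS, rfl⟩ := hg
  obtain ⟨w', hw', hS', rfl⟩ := hh
  refine ⟨w ++ w', by simp; omega, fun a ha => ?_, by simp⟩
  rcases List.mem_append.1 ha with h | h
  exacts [hS a h, hS' a h]

theorem inv_mem_wordBall {G : Type*} [Group G] {S : Set G} {n : ℕ} {g : G}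
    (hg : g ∈ wordBall S n) : g⁻¹ ∈ wordBall S n := by
  obtain ⟨w, hw, hS, rfl⟩ := hg
  refine ⟨(w.map (·⁻¹)).reverse, by simpa using hw, fun a ha => ?_, (List.prod_inv_reverse w).symm⟩
  simp only [List.mem_reverse, List.mem_map] at ha
  obtain ⟨b, hb, rfl⟩ := ha
  rw [inv_inv]
  exact (hS b hb).symm

theorem exists_mem_wordBall {G : Type*} [Group G] {S : Set G} (hS : Subgroup.closure S = ⊤)
    (g : G) : ∃ n, g ∈ wordBall S n := by
  have hg : g ∈ Subgroup.closure S := hS ▸ Subgroup.mem_top g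
  induction hg using Subgroup.closure_induction with
  | mem x hx => exact ⟨1, [x], by simp, by simp [hx], by simp⟩
  | one => exact ⟨0, one_mem_wordBall S 0⟩
  | mul x y _ _ hx hy =>
    obtain ⟨m, hm⟩ := hx
    obtain ⟨n, hn⟩ := hy
    exact ⟨m + n, mul_mem_wordBall hm hn⟩
  | inv x _ hx =>
    obtain ⟨n, hn⟩ := hx
    exact ⟨n, inv_mem_wordBall hn⟩

/-- Lower bounds on `ncard` need this, since `ncard` is `0` on infinite sets. -/
theorem finite_wordBall {G : Type*} [Group G] {S : Set G} (hS : S.Finite) (n : ℕ) :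
    (wordBall S n).Finite := by
  have hT : (S ∪ S⁻¹).Finite := hS.union hS.inv
  have := hT.to_subtype
  refine ((List.finite_length_le (S ∪ S⁻¹ : Set G) n).image
    fun w => (w.map Subtype.val).prod).subset ?_
  rintro g ⟨w, hw, h, rfl⟩
  have h' : ∀ a ∈ w, a ∈ S ∪ S⁻¹ := h
  lift w to List (S ∪ S⁻¹ : Set G) using h'
  exact ⟨w, by simpa using hw, rfl⟩

/-- The product of a nonempty word in two letters, as an element of the free semigroup. -/
def FreeSemigroup.ofFn {n : ℕ} (f : Fin (n + 1) → Fin 2) : FreeSemigroup (Fin 2) :=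
  ⟨f 0, List.ofFn fun i : Fin n => f i.succ⟩

theorem FreeSemigroup.ofFn_injective (n : ℕ) :
    Function.Injective (FreeSemigroup.ofFn (n := n)) := by
  intro f g h
  simp only [FreeSemigroup.ofFn, FreeSemigroup.mk.injEq, List.ofFn_inj] at h
  funext i
  exact Fin.cases h.1 (fun i => congrFun h.2 i) i

theorem map_mem_wordBall {G : Type*} [Group G] {S : Set G} {m : ℕ}
    (ι : FreeSemigroup (Fin 2) →ₙ* G) (h : ∀ i, ι (FreeSemigroup.of i) ∈ wordBall S m) :
    ∀ u : FreeSemigroup (Fin 2), ι u ∈ wordBall S (u.length * m) := by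
  intro u
  induction u using FreeSemigroup.recOnMul with
  | ih1 i => simpa using h i
  | ih2 i u hi hu =>
    rw [map_mul, FreeSemigroup.length_mul, add_mul]
    exact mul_mem_wordBall hi hu

/-- The words of length `n` in two letters have distinct images. The case `n = 0` is separate
because a free semigroup has no empty word. -/
theorem two_pow_le_ncard_wordBall {G : Type*} [Group G] {S : Set G} (hS : S.Finite) {m : ℕ}
    (ι : FreeSemigroup (Fin 2) →ₙ* G) (hι : Function.Injective ι)
    (h : ∀ i, ι (FreeSemigroup.of i) ∈ wordBall S m) (n : ℕ) :
    2 ^ n ≤ (wordBall S (n * m)).ncard := by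
  rcases n with _ | n
  · simpa [Nat.one_le_iff_ne_zero] using
      (Set.ncard_pos (finite_wordBall hS 0)).2 ⟨1, one_mem_wordBall S 0⟩ |>.ne'
  have hinj := hι.comp (FreeSemigroup.ofFn_injective n)
  calc 2 ^ (n + 1) = (Set.range (ι ∘ FreeSemigroup.ofFn (n := n))).ncard := by
        rw [← Set.image_univ, Set.ncard_image_of_injective _ hinj, Set.ncard_univ,
          Nat.card_eq_fintype_card]
        simp
    _ ≤ _ := by
        refine Set.ncard_le_ncard ?_ (finite_wordBall hS _)
        rintro _ ⟨f, rfl⟩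
        simpa [FreeSemigroup.ofFn, FreeSemigroup.length] using
          map_mem_wordBall ι h (FreeSemigroup.ofFn f)

theorem hasExponentialGrowth_of_freeSemigroup {G : Type*} [Group G] (hG : Group.FG G)
    (ι : FreeSemigroup (Fin 2) →ₙ* G) (hι : Function.Injective ι) : HasExponentialGrowth G := by
  refine ⟨hG, fun S hS hcl => ?_⟩
  obtain ⟨m₀, h₀⟩ := exists_mem_wordBall hcl (ι (FreeSemigroup.of 0))
  obtain ⟨m₁, h₁⟩ := exists_mem_wordBall hcl (ι (FreeSemigroup.of 1))
  -- A common radius for both free generators; the `+ 1` makes it visibly positive.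
  set m := m₀ + m₁ + 1 with hm
  have h : ∀ i, ι (FreeSemigroup.of i) ∈ wordBall S m := by
    intro i
    fin_cases i
    exacts [wordBall_mono S (by omega) h₀, wordBall_mono S (by omega) h₁]
  have hmpos : (0 : ℝ) < m := by positivity
  have hone : ∀ n, 1 ≤ (wordBall S n).ncard := fun n =>
    (Set.ncard_pos (finite_wordBall hS n)).2 ⟨1, one_mem_wordBall S n⟩
  -- Radii `1 ≤ n < m` are too small to contain free words for certain, yet the bound there exceeds
  -- `1`; a nontrivial generator supplies a second element.
  have htwo : ∀ n, 1 ≤ n → 2 ≤ (wordBall S n).ncard := by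
    intro n hn
    have hne : ∃ a ∈ S, a ≠ 1 := by
      by_contra! hc
      have : Subgroup.closure S ≤ ⊥ := (Subgroup.closure_le _).2 fun a ha => hc a ha
      rw [hcl] at this
      have e0 := Subgroup.mem_bot.1 (this (Subgroup.mem_top (ι (FreeSemigroup.of 0))))
      have e1 := Subgroup.mem_bot.1 (this (Subgroup.mem_top (ι (FreeSemigroup.of 1))))
      have := hι (e0.trans e1.symm)
      simp [FreeSemigroup.of] at this
    obtain ⟨a, ha, ha1⟩ := hne
    rw [← Set.ncard_pair ha1]
    refine Set.ncard_le_ncard ?_ (finite_wordBall hS n)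
    rintro x (rfl | rfl)
    · exact ⟨[x], by simpa using hn, by simp [ha], by simp⟩
    · exact one_mem_wordBall S n
  -- The factor `2` absorbs the rounding: `n ≤ 2 * m * (n / m)` as soon as `m ≤ n`.
  refine ⟨(2 : ℝ) ^ (1 / (2 * m : ℝ)), Real.one_lt_rpow (by norm_num) (by positivity), fun n => ?_⟩
  rw [← Real.rpow_natCast, ← Real.rpow_mul (by norm_num)]
  have key : ∀ k : ℕ, n ≤ 2 * m * k → 2 ^ k ≤ (wordBall S n).ncard →
      (2 : ℝ) ^ (1 / (2 * m : ℝ) * n) ≤ (wordBall S n).ncard := by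
    intro k hk hc
    have h1 : 1 / (2 * m : ℝ) * n ≤ k := by
      rw [one_div, inv_mul_le_iff₀ (by positivity)]
      exact_mod_cast hk
    calc (2 : ℝ) ^ (1 / (2 * m : ℝ) * n) ≤ (2 : ℝ) ^ (k : ℝ) :=
          Real.rpow_le_rpow_of_exponent_le (by norm_num) h1
      _ = ((2 ^ k : ℕ) : ℝ) := by rw [Real.rpow_natCast]; push_cast; rfl
      _ ≤ _ := by exact_mod_cast hc
  rcases Nat.eq_zero_or_pos n with rfl | hn
  · exact key 0 (by simp) (by simpa using hone 0)
  rcases lt_or_ge n m with hnm | hnm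
  · exact key 1 (by omega) (by simpa using htwo n hn)
  · refine key (n / m) ?_ ((two_pow_le_ncard_wordBall hS ι hι h _).trans
      (Set.ncard_le_ncard (wordBall_mono S (Nat.div_mul_le_self n m)) (finite_wordBall hS n)))
    have h1 := Nat.div_add_mod n m
    have h2 := Nat.mod_lt n (show m > 0 by omega)
    have h3 : 1 ≤ n / m := (Nat.one_le_div_iff (by omega)).2 hnm
    nlinarith

/-! ### Linearity -/

/-- A product of more than `n ^ 2` copies of a noncommutative group has no faithful representation of degree `n`. -/
theorem not_injective_pi_perm {K : Type v} [Field K] {m n : ℕ}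
    (hm : n * n < m) (ρ : (Fin m → Equiv.Perm (Fin 3)) →* Matrix.GeneralLinearGroup (Fin n) K) :
    ¬ Function.Injective ρ := by
  intro hρ
  -- `C k` is the space of matrices commuting with the first `k` factors
  let C : ℕ → Submodule K (Matrix (Fin n) (Fin n) K) := fun k =>
    { carrier := {M | ∀ i : Fin m, i.1 < k → ∀ g, (ρ (Pi.mulSingle i g)).1 * M =
        M * (ρ (Pi.mulSingle i g)).1}
      add_mem' := fun {a b} ha hb i hi g => by rw [mul_add, add_mul, ha i hi g, hb i hi g]
      zero_mem' := fun i hi g => by simp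
      smul_mem' := fun c a ha i hi g => by rw [mul_smul_comm, smul_mul_assoc, ha i hi g] }
  have hlt : ∀ k, k < m → C (k + 1) < C k := by
    intro k hk
    refine lt_of_le_of_ne (fun M hM i hi g => hM i (by omega) g) fun heq => ?_
    -- The factor of index `k` commutes with the earlier ones. Were `C (k + 1) = C k`, it would
    -- commute with itself as well, contradicting faithfulness. So the commutants drop in dimension
    -- `m > n * n` times.
    have hmem : ∀ g, (ρ (Pi.mulSingle ⟨k, hk⟩ g)).1 ∈ C k := by
      intro g i hi h
      have hne : i ≠ ⟨k, hk⟩ := fun h => by simp [h] at hi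
      have := Pi.mulSingle_commute (f := fun _ => Equiv.Perm (Fin 3)) hne h g
      rw [← Units.val_mul, ← Units.val_mul, ← map_mul, ← map_mul, this.eq]
    have hcomm : ∀ g h : Equiv.Perm (Fin 3), h * g = g * h := by
      intro g h
      have h1 := hmem g
      rw [← heq] at h1
      have h2 := h1 ⟨k, hk⟩ (Nat.lt_succ_self k) h
      rw [← Units.val_mul, ← Units.val_mul, ← map_mul, ← map_mul, Units.val_inj] at h2
      have h3 := hρ h2
      rw [← Pi.mulSingle_mul, ← Pi.mulSingle_mul] at h3
      exact Pi.mulSingle_injective (M := fun _ => Equiv.Perm (Fin 3)) _ h3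
    exact absurd (hcomm (Equiv.swap 0 1) (Equiv.swap 1 2)) (by decide)
  have hdim : ∀ k, k ≤ m → Module.finrank K (C k) + k ≤ n * n := by
    intro k
    induction k with
    | zero =>
      intro _
      have := Submodule.finrank_le (C 0)
      simpa [Module.finrank_matrix] using this
    | succ k ih =>
      intro hk
      have h1 := Submodule.finrank_lt_finrank_of_lt (hlt k (by omega))
      have h2 := ih (by omega)
      omega
  have := hdim m le_rfl
  omega

theorem not_isLinearGroup_of_finite_embed {G : Type*} [Group G]
    (h : ∀ (H : Type) [Group H] [Finite H], ∃ ι : H →* G, Function.Injective ι) :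
    ¬ IsLinearGroup.{v} G := by
  rintro ⟨K, _, n, ρ, hρ⟩
  obtain ⟨ι, hι⟩ := h (Fin (n * n + 1) → Equiv.Perm (Fin 3))
  exact not_injective_pi_perm (Nat.lt_succ_self _) (ρ.comp ι) (hρ.comp hι)

/-! ### Free semigroups -/

theorem FreeSemigroup.eq_of_or_mul (u : FreeSemigroup (Fin 2)) :
    (∃ i, u = .of i) ∨ ∃ i v, u = .of i * v := by
  induction u using FreeSemigroup.recOnMul with
  | ih1 i => exact Or.inl ⟨i, rfl⟩
  | ih2 i v _ _ => exact Or.inr ⟨i, v, rfl⟩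

/-- If no word beginning with `x 0` equals a word beginning with `x 1`, then `x 0` and `x 1`
generate a free semigroup. -/
theorem exists_freeSemigroup_injective {G : Type*} [Group G] (x : Fin 2 → G)
    (h : ∀ w ∈ Submonoid.closure (Set.range x), ∀ w' ∈ Submonoid.closure (Set.range x),
      x 0 * w ≠ x 1 * w') :
    ∃ ι : FreeSemigroup (Fin 2) →ₙ* G, Function.Injective ι := by
  set N := Submonoid.closure (Set.range x)
  have hx : ∀ i, x i ∈ N := fun i => Submonoid.subset_closure ⟨i, rfl⟩
  set ι := FreeSemigroup.lift x
  have hof : ∀ i, ι (.of i) = x i := fun i => FreeSemigroup.lift_of x i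
  have hN : ∀ u, ι u ∈ N := by
    intro u
    induction u using FreeSemigroup.recOnMul with
    | ih1 i => rw [hof]; exact hx i
    | ih2 i v hi hv => rw [map_mul]; exact N.mul_mem hi hv
  have h' : ∀ i j, ∀ w ∈ N, ∀ w' ∈ N, x i * w = x j * w' → i = j := by
    intro i j w hw w' hw' he
    by_contra hij
    have : (i = 0 ∧ j = 1) ∨ (i = 1 ∧ j = 0) := by omega
    rcases this with ⟨rfl, rfl⟩ | ⟨rfl, rfl⟩
    exacts [h w hw w' hw' he, h w' hw' w hw he.symm]
  -- If `x i * w = 1`, then `x i * (w * x j) = x j` for both `j`, so the first letter `i` would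
  -- equal each `j`.
  have hone : ∀ u, ι u ≠ 1 := by
    intro u hu
    have key : ∀ i, ∀ w ∈ N, x i * w ≠ 1 := by
      intro i w hw he
      have h2 : ∀ j, i = j := fun j => h' i j (w * x j) (N.mul_mem hw (hx j)) 1 N.one_mem <| by
        rw [← mul_assoc, he, one_mul, mul_one]
      exact absurd ((h2 0).symm.trans (h2 1)) (by decide)
    rcases u.eq_of_or_mul with ⟨i, rfl⟩ | ⟨i, v, rfl⟩
    · exact key i 1 N.one_mem (by rw [mul_one, ← hof, hu])
    · exact key i _ (hN v) (by rw [← hof, ← map_mul, hu])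
  refine ⟨ι, fun u => ?_⟩
  induction u using FreeSemigroup.recOnMul with
  | ih1 i =>
    intro v hv
    rcases v.eq_of_or_mul with ⟨j, rfl⟩ | ⟨j, v, rfl⟩
    · rw [hof, hof] at hv
      rw [h' i j 1 N.one_mem 1 N.one_mem (by rw [hv])]
    · rw [map_mul, hof, hof] at hv
      obtain rfl := h' i j 1 N.one_mem _ (hN v) (by rw [mul_one, hv])
      exact absurd (left_eq_mul.1 hv) (hone v)
  | ih2 i u _ ih =>
    intro v hv
    rcases v.eq_of_or_mul with ⟨j, rfl⟩ | ⟨j, v, rfl⟩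
    · rw [map_mul, hof, hof] at hv
      obtain rfl := h' i j _ (hN u) 1 N.one_mem (by rw [mul_one, hv])
      exact absurd (mul_eq_left.1 hv) (hone u)
    · rw [map_mul, map_mul, hof, hof] at hv
      obtain rfl := h' i j _ (hN u) _ (hN v) hv
      rw [ih (mul_left_cancel hv)]

/-! ### Left germs -/

namespace IETDomain

/-- `f` maps the left germ of `D` at `v` to the left germ of `E` at `w`. -/
def MapsLeftGerm {D E : IETDomain} (f : D.Point → E.Point) (v : D.Point) (w : E.Point) : Prop :=
  ∃ ε > 0, ∀ t, 0 < t → t < ε → ∀ z, D.Shift z t v → E.Shift (f z) t w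

theorem MapsLeftGerm.comp {D E F : IETDomain} {f : D.Point → E.Point} {g : E.Point → F.Point}
    {u : D.Point} {v : E.Point} {w : F.Point} (hg : MapsLeftGerm g v w)
    (hf : MapsLeftGerm f u v) : MapsLeftGerm (g ∘ f) u w := by
  obtain ⟨ε, hε, hf⟩ := hf
  obtain ⟨ε', hε', hg⟩ := hg
  exact ⟨min ε ε', lt_min hε hε', fun t h0 ht z hz =>
    hg t h0 (ht.trans_le (min_le_right _ _)) _ (hf t h0 (ht.trans_le (min_le_left _ _)) z hz)⟩

end IETDomain

namespace circleIntervalDomain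

open IETDomain

/-- Every point of the circle has points just to its left, so the germ condition is not vacuous
there; at the left end of the interval it would be. -/
theorem MapsLeftGerm.right_unique {f : circleIntervalDomain.Point → circleIntervalDomain.Point}
    {c : AddCircle (2 : ℝ)} {v w : circleIntervalDomain.Point}
    (hv : MapsLeftGerm f (onCircle c) v) (hw : MapsLeftGerm f (onCircle c) w) : v = w := by
  obtain ⟨ε, hε, hv⟩ := hv
  obtain ⟨ε', hε', hw⟩ := hw
  have h0 : 0 < min ε ε' := lt_min hε hε'
  set t := min ε ε' / 2
  have hz : circleIntervalDomain.Shift (onCircle (c - (t : AddCircle (2 : ℝ)))) t (onCircle c) :=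
    (sub_add_cancel c _).symm
  have ht : t < min ε ε' := half_lt_self h0
  exact shift_right_unique _ (hv t (half_pos h0) (ht.trans_le (min_le_left _ _)) _ hz)
    (hw t (half_pos h0) (ht.trans_le (min_le_right _ _)) _ hz)

theorem rotation_onCircle (θ : ℝ) (c : AddCircle (2 : ℝ)) :
    (rotation θ).1 (onCircle c) = onCircle (c + (θ : AddCircle (2 : ℝ))) := rfl

theorem rotation_onInterval (θ : ℝ) (x : Set.Ico (0 : ℝ) 1) :
    (rotation θ).1 (onInterval x) = onInterval x := rfl

theorem rotation_inv_onCircle (θ : ℝ) (c : AddCircle (2 : ℝ)) :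
    (rotation θ)⁻¹.1 (onCircle c) = onCircle (c - (θ : AddCircle (2 : ℝ))) :=
  congrArg Sum.inl (sub_eq_add_neg _ _).symm

theorem rotation_inv_onInterval (θ : ℝ) (x : Set.Ico (0 : ℝ) 1) :
    (rotation θ)⁻¹.1 (onInterval x) = onInterval x := rfl

theorem rotation_inv_mapsLeftGerm (θ : ℝ) (v : circleIntervalDomain.Point) :
    MapsLeftGerm (D := circleIntervalDomain) (E := circleIntervalDomain)
      (rotation θ)⁻¹.1 v ((rotation θ)⁻¹.1 v) := by
  refine ⟨1, one_pos, fun t _ _ z => ?_⟩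
  revert v z
  refine cases (fun c => cases (fun d h => ?_) fun _ h => h.elim) fun x =>
    cases (fun _ h => h.elim) fun y h => h
  have h' : c = d + (t : AddCircle (2 : ℝ)) := h
  rw [rotation_inv_onCircle, rotation_inv_onCircle, h']
  exact add_sub_right_comm d (t : AddCircle (2 : ℝ)) (θ : AddCircle (2 : ℝ))

theorem swap_arc {u : ℝ} (h0 : 0 ≤ u) (h1 : u < 1) :
    swap.1 (onCircle (u : AddCircle (2 : ℝ))) = onInterval ⟨u, h0, h1⟩ := swapFun_arc h0 h1

theorem swap_outside {u : ℝ} (h1 : 1 ≤ u) (h2 : u < 2) :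
    swap.1 (onCircle (u : AddCircle (2 : ℝ))) = onCircle (u : AddCircle (2 : ℝ)) :=
  swapFun_outside h1 h2

theorem coe_sub_two (u : ℝ) : ((u - 2 : ℝ) : AddCircle (2 : ℝ)) = u := by
  rw [AddCircle.coe_sub, AddCircle.coe_period, sub_zero]

theorem swap_outside_neg {u : ℝ} (h1 : -1 ≤ u) (h2 : u < 0) :
    swap.1 (onCircle (u : AddCircle (2 : ℝ))) = onCircle (u : AddCircle (2 : ℝ)) := by
  have := swap_outside (u := u + 2) (by linarith) (by linarith)
  rwa [← coe_sub_two (u + 2), add_sub_cancel_right] at this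

theorem swap_interval (x : Set.Ico (0 : ℝ) 1) :
    swap.1 (onInterval x) = onCircle (x.1 : AddCircle (2 : ℝ)) := rfl

theorem swap_inv : swap⁻¹ = swap :=
  Subtype.ext (Equiv.ext fun _ => rfl)

/-- A left shift of a point on the circle, in coordinates. -/
theorem exists_of_shift_onCircle {z : circleIntervalDomain.Point} {t u : ℝ}
    (h : circleIntervalDomain.Shift z t (onCircle (u : AddCircle (2 : ℝ)))) :
    z = onCircle ((u - t : ℝ) : AddCircle (2 : ℝ)) := by
  revert z
  suffices h : ∀ z, circleIntervalDomain.Shift z t (onCircle (u : AddCircle (2 : ℝ))) →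
      z = onCircle ((u - t : ℝ) : AddCircle (2 : ℝ)) from fun {z} => h z
  refine cases (fun c h => ?_) fun _ h => h.elim
  have h' : (u : AddCircle (2 : ℝ)) = c + (t : AddCircle (2 : ℝ)) := h
  rw [AddCircle.coe_sub, h', add_sub_cancel_right]

theorem shift_onCircle (u t : ℝ) : circleIntervalDomain.Shift
    (onCircle ((u - t : ℝ) : AddCircle (2 : ℝ))) t (onCircle (u : AddCircle (2 : ℝ))) := by
  show _ = _ + _
  rw [← AddCircle.coe_add, sub_add_cancel]

/-- The arc `[-1, 0)` is fixed, although the point `0` itself is sent into the interval. This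
discrepancy distinguishes first letters of words. -/
theorem swap_mapsLeftGerm_zero : MapsLeftGerm (D := circleIntervalDomain)
    (E := circleIntervalDomain) swap.1 (onCircle ((0 : ℝ) : AddCircle (2 : ℝ)))
    (onCircle ((0 : ℝ) : AddCircle (2 : ℝ))) := by
  refine ⟨1, one_pos, fun t h0 h1 z hz => ?_⟩
  rw [exists_of_shift_onCircle hz, swap_outside_neg (by linarith) (by linarith)]
  exact shift_onCircle 0 t

theorem swap_mapsLeftGerm_onCircle {u : ℝ} (h0 : 0 < u) (h2 : u < 2) (h1 : u ≠ 1) :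
    MapsLeftGerm (D := circleIntervalDomain) (E := circleIntervalDomain) swap.1
      (onCircle (u : AddCircle (2 : ℝ))) (swap.1 (onCircle (u : AddCircle (2 : ℝ)))) := by
  rcases lt_or_gt_of_ne h1 with h1 | h1
  · refine ⟨u, h0, fun t ht ht' z hz => ?_⟩
    rw [exists_of_shift_onCircle hz, swap_arc h0.le h1, swap_arc (by linarith) (by linarith)]
    exact (sub_add_cancel u t).symm
  · refine ⟨u - 1, by linarith, fun t ht ht' z hz => ?_⟩
    rw [exists_of_shift_onCircle hz, swap_outside h1.le h2,
      swap_outside (by linarith) (by linarith)]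
    exact shift_onCircle u t

theorem swap_mapsLeftGerm_onInterval (x : Set.Ico (0 : ℝ) 1) :
    MapsLeftGerm (D := circleIntervalDomain) (E := circleIntervalDomain) swap.1
      (onInterval x) (swap.1 (onInterval x)) := by
  refine ⟨1, one_pos, fun t _ _ z => ?_⟩
  revert z
  refine cases (fun _ h => h.elim) fun y h => ?_
  have h' : x.1 = y.1 + t := h
  rw [swap_interval, swap_interval, h', AddCircle.coe_add]
  rfl

/-! ### The negative orbit of `0` and the free semigroup -/

/-- The position on the circle of a point, the interval being identified with the arc `[0, 1)`. -/
noncomputable def position : circleIntervalDomain.Point → AddCircle (2 : ℝ) :=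
  Sum.elim id fun x : Set.Ico (0 : ℝ) 1 => (x.1 : AddCircle (2 : ℝ))

theorem position_onCircle (c : AddCircle (2 : ℝ)) : position (onCircle c) = c := rfl

theorem position_swap (v : circleIntervalDomain.Point) :
    position (swap.1 v) = position v := by
  revert v
  refine cases (fun c => ?_) fun x => rfl
  obtain ⟨u, ⟨h0, h2⟩, rfl⟩ := AddCircle.eq_coe_Ico c
  rcases lt_or_ge u 1 with h | h
  · rw [swap_arc h0 h]; rfl
  · rw [swap_outside h h2]

/-- The point `v` lies over the strictly negative orbit of `0` under the rotation by `θ`. -/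
def IsNegOrbit (θ : ℝ) (v : circleIntervalDomain.Point) : Prop :=
  ∃ m : ℕ, 1 ≤ m ∧ position v = ((-(m * θ) : ℝ) : AddCircle (2 : ℝ))

theorem IsNegOrbit.swap {θ : ℝ} {v : circleIntervalDomain.Point} (h : IsNegOrbit θ v) :
    IsNegOrbit θ (swap.1 v) := by
  rwa [IsNegOrbit, position_swap]

theorem IsNegOrbit.rotation_inv {θ : ℝ} {v : circleIntervalDomain.Point} (h : IsNegOrbit θ v) :
    IsNegOrbit θ ((rotation θ)⁻¹.1 v) := by
  revert v
  suffices h : ∀ v, IsNegOrbit θ v → IsNegOrbit θ ((rotation θ)⁻¹.1 v) from fun {v} => h v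
  refine cases (fun c h => ?_) fun x h => h
  obtain ⟨m, hm, h⟩ := h
  refine ⟨m + 1, by omega, ?_⟩
  rw [position_onCircle] at h
  rw [rotation_inv_onCircle, position_onCircle, h, ← AddCircle.coe_sub]
  congr 1
  push_cast
  ring

theorem ne_int_of_coe_eq {θ : ℝ} (hθ : Irrational θ) {m : ℕ} (hm : 1 ≤ m) {u : ℝ}
    (h : (u : AddCircle (2 : ℝ)) = ((-(m * θ) : ℝ) : AddCircle (2 : ℝ))) (k : ℤ) : u ≠ k := by
  rintro rfl
  rw [← sub_eq_zero, ← AddCircle.coe_sub, AddCircle.coe_eq_zero_iff] at h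
  obtain ⟨n, hn⟩ := h
  have hirr : Irrational (m * θ) := hθ.natCast_mul (by omega)
  refine hirr.ne_int (n * 2 - k) ?_
  simp only [zsmul_eq_mul] at hn
  push_cast
  linarith

/-- On the circle the swap is discontinuous from the left only at `0` and `1`, which irrationality
keeps off the negative orbit. -/
theorem IsNegOrbit.swap_mapsLeftGerm {θ : ℝ} (hθ : Irrational θ)
    {v : circleIntervalDomain.Point} (h : IsNegOrbit θ v) :
    MapsLeftGerm (D := circleIntervalDomain) (E := circleIntervalDomain)
      circleIntervalDomain.swap.1 v (circleIntervalDomain.swap.1 v) := by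
  revert v
  suffices h : ∀ v, IsNegOrbit θ v → MapsLeftGerm (D := circleIntervalDomain)
    (E := circleIntervalDomain) circleIntervalDomain.swap.1 v (circleIntervalDomain.swap.1 v) from
    fun {v} => h v
  refine cases (fun c => ?_) fun x _ => swap_mapsLeftGerm_onInterval x
  rintro ⟨m, hm, h⟩
  obtain ⟨u, ⟨h0, h2⟩, rfl⟩ := AddCircle.eq_coe_Ico c
  have hne := ne_int_of_coe_eq hθ hm h
  exact swap_mapsLeftGerm_onCircle (lt_of_le_of_ne h0 (by simpa using (hne 0).symm)) h2
    (by simpa using hne 1)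

/-- Inverses of the generators never increase `-mθ` to an end of the arc: a rotation step lowers the
position by `θ` on the circle and keeps it on the interval, and the swap preserves it. So left
continuity persists along the word. -/
theorem mapsLeftGerm_of_mem_closure {θ : ℝ} (hθ : Irrational θ) {w : IET circleIntervalDomain}
    (hw : w ∈ Submonoid.closure {rotation θ, swap * rotation θ}) :
    ∀ v, IsNegOrbit θ v → IsNegOrbit θ (w⁻¹.1 v) ∧
      MapsLeftGerm (D := circleIntervalDomain) (E := circleIntervalDomain) w⁻¹.1 v (w⁻¹.1 v) := by
  induction hw using Submonoid.closure_induction with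
  | mem w hw =>
    intro v hv
    rcases hw with rfl | rfl
    · exact ⟨hv.rotation_inv, rotation_inv_mapsLeftGerm θ v⟩
    · rw [mul_inv_rev, swap_inv]
      exact ⟨hv.swap.rotation_inv,
        (rotation_inv_mapsLeftGerm θ _).comp (hv.swap_mapsLeftGerm hθ)⟩
  | one => exact fun v hv => ⟨hv, 1, one_pos, fun t _ _ z hz => hz⟩
  | mul w w' _ _ hw hw' =>
    intro v hv
    rw [mul_inv_rev]
    obtain ⟨h1, h2⟩ := hw v hv
    obtain ⟨h3, h4⟩ := hw' _ h1
    exact ⟨h3, h4.comp h2⟩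

/-- Invert the two words. On the left germ at `0` the extra swap is invisible, so `w⁻¹` and `w'⁻¹`
agree at `-θ`; on the point `0` the swap jumps to the interval, and injectivity of `w'⁻¹` would then
equate a point of the circle with one of the interval. -/
theorem rotation_mul_ne_swap_mul {θ : ℝ} (hθ : Irrational θ) {w w' : IET circleIntervalDomain}
    (hw : w ∈ Submonoid.closure {rotation θ, swap * rotation θ})
    (hw' : w' ∈ Submonoid.closure {rotation θ, swap * rotation θ}) :
    rotation θ * w ≠ swap * rotation θ * w' := by
  intro heq
  have hinv : w⁻¹ * (rotation θ)⁻¹ = w'⁻¹ * ((rotation θ)⁻¹ * swap) := by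
    rw [← mul_inv_rev, heq, mul_inv_rev, mul_inv_rev, swap_inv]
  set p := onCircle ((0 : ℝ) : AddCircle (2 : ℝ)) with hp
  set v := (rotation θ)⁻¹.1 p with hv
  have hneg : IsNegOrbit θ v := by
    refine ⟨1, le_rfl, ?_⟩
    rw [hv, hp, rotation_inv_onCircle, position_onCircle, ← AddCircle.coe_sub]
    congr 1
    simp
  have g1 : MapsLeftGerm (D := circleIntervalDomain) (E := circleIntervalDomain)
      (w⁻¹ * (rotation θ)⁻¹).1 p (w⁻¹.1 v) :=
    (mapsLeftGerm_of_mem_closure hθ hw v hneg).2.comp (rotation_inv_mapsLeftGerm θ p)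
  have g2 : MapsLeftGerm (D := circleIntervalDomain) (E := circleIntervalDomain)
      (w'⁻¹ * ((rotation θ)⁻¹ * swap)).1 p (w'⁻¹.1 v) :=
    (mapsLeftGerm_of_mem_closure hθ hw' v hneg).2.comp
      ((rotation_inv_mapsLeftGerm θ p).comp swap_mapsLeftGerm_zero)
  rw [hinv] at g1
  have h1 : w⁻¹.1 v = w'⁻¹.1 v := MapsLeftGerm.right_unique g1 g2
  have h2 : w⁻¹.1 v = w'⁻¹.1 ((rotation θ)⁻¹.1 (swap.1 p)) :=
    congrArg (fun g : IET circleIntervalDomain => g.1 p) hinv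
  have h3 := w'⁻¹.1.injective (h1.symm.trans h2)
  rw [swap_arc le_rfl one_pos, rotation_inv_onInterval, hv, hp, rotation_inv_onCircle] at h3
  exact Sum.inl_ne_inr h3

/-- The rotation and its product with the swap generate a free semigroup of rank two. -/
theorem exists_freeSemigroup_closure {θ : ℝ} (hθ : Irrational θ) :
    ∃ ι : FreeSemigroup (Fin 2) →ₙ* Subgroup.closure {rotation θ, swap},
      Function.Injective ι := by
  set F := Subgroup.closure {rotation θ, swap}
  have hr : rotation θ ∈ F := Subgroup.subset_closure (Or.inl rfl)
  have hs : swap ∈ F := Subgroup.subset_closure (Or.inr rfl)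
  let x : Fin 2 → F := ![⟨rotation θ, hr⟩, ⟨swap * rotation θ, F.mul_mem hs hr⟩]
  have hmem : ∀ w ∈ Submonoid.closure (Set.range x),
      (w : IET circleIntervalDomain) ∈ Submonoid.closure {rotation θ, swap * rotation θ} := by
    intro w hw
    have := Submonoid.mem_map_of_mem F.subtype hw
    rw [MonoidHom.map_mclosure] at this
    refine Submonoid.closure_mono ?_ this
    rintro _ ⟨_, ⟨i, rfl⟩, rfl⟩
    fin_cases i
    exacts [Or.inl rfl, Or.inr rfl]
  exact exists_freeSemigroup_injective x fun w hw w' hw' he =>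
    rotation_mul_ne_swap_mul hθ (hmem w hw) (hmem w' hw') (congrArg Subtype.val he)

end circleIntervalDomain

/-! ### Star permutations -/

section StarPerm

variable {κ : Type*}

/-- The permutation exchanging `none` with `some i`, and `(i, false)` with `(i, true)`. -/
def starPerm [DecidableEq κ] (i : κ) : Equiv.Perm (Option κ ⊕ κ × Bool) :=
  Equiv.Perm.sumCongr (Equiv.swap none (some i)) (Equiv.swap (i, false) (i, true))

/-- Each two-element fibre is either fixed or flipped. -/
theorem mul_self_of_fst_eq {v : Equiv.Perm (κ × Bool)} (hv : ∀ x, (v x).1 = x.1) :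
    v * v = 1 := by
  ext1 ⟨i, b⟩
  have h : ∀ b, ∃ b', v (i, b) = (i, b') := fun b => ⟨(v (i, b)).2, Prod.ext (hv _) rfl⟩
  obtain ⟨c, hc⟩ := h false
  obtain ⟨d, hd⟩ := h true
  have hne : c ≠ d := by
    rintro rfl
    simpa using v.injective (hc.trans hd.symm)
  cases b <;> cases c <;> cases d <;> simp_all

/-- Transpositions through the common letter `none` generate all permutations; the private pairs
only record flips. -/
theorem exists_sumCongr_mem_closure_starPerm [DecidableEq κ] [Finite κ] (g : Equiv.Perm (Option κ)) :
    ∃ v : Equiv.Perm (κ × Bool), (∀ x, (v x).1 = x.1) ∧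
      Equiv.Perm.sumCongr g v ∈ Subgroup.closure (Set.range (starPerm (κ := κ))) := by
  set Γ := Subgroup.closure (Set.range (starPerm (κ := κ)))
  let P : Equiv.Perm (Option κ) → Prop := fun g => ∃ v : Equiv.Perm (κ × Bool),
    (∀ x, (v x).1 = x.1) ∧ Equiv.Perm.sumCongr g v ∈ Γ
  have hmul : ∀ g h, P g → P h → P (g * h) := by
    rintro g h ⟨v, hv, hg⟩ ⟨w, hw, hh⟩
    refine ⟨v * w, fun x => ?_, ?_⟩
    · rw [Equiv.Perm.mul_apply, hv, hw]
    · rw [← Equiv.Perm.sumCongr_mul]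
      exact Γ.mul_mem hg hh
  have hone : P 1 := ⟨1, fun _ => rfl, by rw [Equiv.Perm.sumCongr_one]; exact Γ.one_mem⟩
  have hstar : ∀ i, P (Equiv.swap none (some i)) := fun i =>
    ⟨Equiv.swap (i, false) (i, true), fun x => by
      rw [Equiv.swap_apply_def]; split_ifs <;> simp_all,
      Subgroup.subset_closure ⟨i, rfl⟩⟩
  have hswap : ∀ x y, x ≠ y → P (Equiv.swap x y) := by
    rintro (_ | i) (_ | j) hne
    · exact absurd rfl hne
    · exact hstar j
    · rw [Equiv.swap_comm]; exact hstar i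
    · have : Equiv.swap (some i) (some j) =
          Equiv.swap none (some j) * Equiv.swap none (some i) * Equiv.swap none (some j) := by
        rw [Equiv.swap_comm none (some i), Equiv.swap_mul_swap_mul_swap (by simp) hne,
          Equiv.swap_comm]
      rw [this]
      exact hmul _ _ (hmul _ _ (hstar j) (hstar i)) (hstar j)
  classical
  have := Fintype.ofFinite κ
  change P g
  induction g using Equiv.Perm.swap_induction_on with
  | one => exact hone
  | swap_mul f x y hxy hf => exact hmul _ _ (hswap x y hxy) hf

theorem sumCongr_one_mem_closure_starPerm [DecidableEq κ] [Fintype κ] {g : Equiv.Perm (Option κ)}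
    (hg : g ∈ alternatingGroup (Option κ)) :
    Equiv.Perm.sumCongr g 1 ∈ Subgroup.closure (Set.range (starPerm (κ := κ))) := by
  set Γ := Subgroup.closure (Set.range (starPerm (κ := κ)))
  let inl : Equiv.Perm (Option κ) →* Equiv.Perm (Option κ ⊕ κ × Bool) :=
    (Equiv.Perm.sumCongrHom _ _).comp (MonoidHom.inl _ _)
  suffices h : alternatingGroup (Option κ) ≤ Γ.comap inl from h hg
  rw [← Equiv.Perm.closure_three_cycles_eq_alternating, Subgroup.closure_le]
  intro g hg
  -- Lift the square of the three-cycle `g` and square the lift: the flips cancel, and `g ^ 4 = g`.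
  obtain ⟨v, hv, hmem⟩ := exists_sumCongr_mem_closure_starPerm (g * g)
  have h3 : g ^ 3 = 1 := by
    rw [← Equiv.Perm.IsThreeCycle.orderOf hg, pow_orderOf_eq_one]
  have h4 : g * g * (g * g) = g := by
    calc g * g * (g * g) = g ^ 3 * g := by rw [pow_three, mul_assoc, mul_assoc, mul_assoc]
      _ = g := by rw [h3, one_mul]
  have := Γ.mul_mem hmem hmem
  rw [Equiv.Perm.sumCongr_mul, mul_self_of_fst_eq hv, h4] at this
  exact this

end StarPerm

/-- Every finite group acts faithfully by even permutations on a set with `n + 1` elements. -/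
theorem exists_hom_alternatingGroup (H : Type u) [Group H] [Finite H] :
    ∃ (n : ℕ) (ι : H →* Equiv.Perm (Option (Fin n))), Function.Injective ι ∧
      ∀ h, ι h ∈ alternatingGroup (Option (Fin n)) := by
  classical
  have := Fintype.ofFinite H
  have hcard : 0 < Fintype.card H := Fintype.card_pos
  -- Two copies of the regular action make every sign a square, hence `1`.
  let e : H ⊕ H ≃ Option (Fin (2 * Fintype.card H - 1)) := Fintype.equivOfCardEq (by
    simp only [Fintype.card_sum, Fintype.card_option, Fintype.card_fin]; omega)
  let c : H →* Equiv.Perm H := MulAction.toPermHom H H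
  let ι : H →* Equiv.Perm (Option (Fin (2 * Fintype.card H - 1))) :=
    (e.permCongrHom.toMonoidHom.comp (Equiv.Perm.sumCongrHom H H)).comp (c.prod c)
  refine ⟨_, ι, ?_, fun h => ?_⟩
  · refine (e.permCongrHom.injective.comp Equiv.Perm.sumCongrHom_injective).comp fun g h hgh => ?_
    exact MulAction.toPerm_injective (congrArg Prod.fst hgh)
  · rw [Equiv.Perm.mem_alternatingGroup]
    show Equiv.Perm.sign (e.permCongr (Equiv.Perm.sumCongr (c h) (c h))) = 1
    rw [Equiv.Perm.sign_permCongr, Equiv.Perm.sign_sumCongr, Int.units_mul_self]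

theorem exists_hom_closure_starPerm (H : Type u) [Group H] [Finite H] :
    ∃ (n : ℕ) (ι : H →* Equiv.Perm (Option (Fin n) ⊕ Fin n × Bool)), Function.Injective ι ∧
      ∀ h, ι h ∈ Subgroup.closure (Set.range (starPerm (κ := Fin n))) := by
  obtain ⟨n, ι, hι, hmem⟩ := exists_hom_alternatingGroup H
  refine ⟨n, ((Equiv.Perm.sumCongrHom _ _).comp (MonoidHom.inl _ _)).comp ι, ?_,
    fun h => sumCongr_one_mem_closure_starPerm (hmem h)⟩
  refine (Equiv.Perm.sumCongrHom_injective.comp fun g h hgh => ?_).comp hι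
  exact congrArg Prod.fst hgh

namespace circleIntervalDomain

/-! ### Small rotations -/

theorem rotation_add (s t : ℝ) : rotation (s + t) = rotation s * rotation t := by
  refine Subtype.ext (Equiv.ext (cases (fun c => ?_) fun x => rfl))
  show onCircle (c + ((s + t : ℝ) : AddCircle (2 : ℝ))) =
    onCircle (c + (t : AddCircle (2 : ℝ)) + (s : AddCircle (2 : ℝ)))
  rw [AddCircle.coe_add, add_assoc, add_comm (s : AddCircle (2 : ℝ))]

theorem rotation_zero : rotation 0 = 1 := by
  have := rotation_add 0 0
  rwa [add_zero, left_eq_mul] at this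

theorem rotation_two : rotation 2 = 1 := by
  refine Subtype.ext (Equiv.ext (cases (fun c => ?_) fun x => rfl))
  show onCircle (c + ((2 : ℝ) : AddCircle (2 : ℝ))) = onCircle c
  rw [AddCircle.coe_period, add_zero]

/-- The angles of the rotations that lie in a given subgroup. -/
noncomputable def rotationAngles (F : Subgroup (IET circleIntervalDomain)) : AddSubgroup ℝ where
  carrier := {t | rotation t ∈ F}
  zero_mem' := by rw [Set.mem_ofPred_eq, rotation_zero]; exact F.one_mem
  add_mem' {s t} hs ht := by rw [Set.mem_ofPred_eq, rotation_add]; exact F.mul_mem hs ht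
  neg_mem' {t} ht := by
    have h : rotation (-t) = (rotation t)⁻¹ := by
      rw [eq_inv_iff_mul_eq_one, ← rotation_add, neg_add_cancel, rotation_zero]
    rw [Set.mem_ofPred_eq, h]
    exact F.inv_mem ht

/-- The subgroup of `ℝ` generated by `θ` and `2` is dense, and rotation by `2` is trivial. -/
theorem exists_small_rotation {θ : ℝ} (hθ : Irrational θ)
    {F : Subgroup (IET circleIntervalDomain)} (hF : rotation θ ∈ F) {ε : ℝ} (hε : 0 < ε) :
    ∃ δ ∈ rotationAngles F, 0 < δ ∧ δ < ε := by
  have hirr : Irrational (θ / 2) := hθ.div_natCast (m := 2) two_ne_zero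
  have hd := dense_addSubgroupClosure_pair_iff.2 hirr
  obtain ⟨δ, hδ, h0, h1⟩ := hd.exists_between hε
  refine ⟨δ, ?_, h0, h1⟩
  refine (AddSubgroup.closure_le (rotationAngles F)).2 ?_ hδ
  rintro t (rfl | rfl)
  · exact hF
  · show rotation 2 ∈ F
    rw [rotation_two]
    exact F.one_mem

/-! ### Involutions with small support -/

theorem rotation_coe (t u : ℝ) : (rotation t).1 (onCircle (u : AddCircle (2 : ℝ))) =
    onCircle ((u + t : ℝ) : AddCircle (2 : ℝ)) := by
  rw [rotation_onCircle, AddCircle.coe_add]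

theorem rotation_swap_coe (t : ℝ) {u : ℝ} (h0 : 0 ≤ u) (h1 : u < 1) :
    (rotation t).1 (swap.1 (onCircle (u : AddCircle (2 : ℝ)))) =
      swap.1 (onCircle (u : AddCircle (2 : ℝ))) := by
  rw [swap_arc h0 h1, rotation_onInterval]

theorem swap_swap (x : circleIntervalDomain.Point) : swap.1 (swap.1 x) = x :=
  swapFun_involutive x

/-- For small `δ > 0`, the involution exchanging the arc `[-δ, 0)` of the circle with the
interval `[0, δ)`, and the arc `[1 - δ, 1)` of the circle with the arc `[1, 1 + δ)`. -/
noncomputable def smallSwap (δ : ℝ) : IET circleIntervalDomain :=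
  swap * rotation δ * swap * rotation (-δ) * swap * rotation (-δ) * swap * rotation δ

theorem smallSwap_apply (δ : ℝ) (x : circleIntervalDomain.Point) : (smallSwap δ).1 x =
    swap.1 ((rotation δ).1 (swap.1 ((rotation (-δ)).1 (swap.1 ((rotation (-δ)).1
      (swap.1 ((rotation δ).1 x))))))) := rfl

/-- This and the next six lemmas follow a point through the word, by position relative to the ends
`0` and `1` of the arc. Away from these ends the rotations and swaps cancel; within `δ` of them a
net displacement remains. -/
theorem smallSwap_left_of_zero {δ u : ℝ} (h0 : 0 < δ) (h1 : δ < 1 / 4)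
    (hu : -δ ≤ u) (hu' : u < 0) :
    (smallSwap δ).1 (onCircle (u : AddCircle (2 : ℝ))) =
      swap.1 (onCircle ((u + δ : ℝ) : AddCircle (2 : ℝ))) := by
  rw [smallSwap_apply, rotation_coe, rotation_swap_coe _ (by linarith) (by linarith), swap_swap,
    rotation_coe, add_neg_cancel_right, swap_outside_neg (by linarith) hu', rotation_coe]

theorem smallSwap_interval_start {δ u : ℝ} (h0 : 0 < δ) (h1 : δ < 1 / 4)
    (hu : 0 ≤ u) (hu' : u < δ) :
    (smallSwap δ).1 (swap.1 (onCircle (u : AddCircle (2 : ℝ)))) =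
      onCircle ((u - δ : ℝ) : AddCircle (2 : ℝ)) := by
  rw [smallSwap_apply, rotation_swap_coe _ hu (by linarith), swap_swap, rotation_coe,
    ← sub_eq_add_neg, swap_outside_neg (by linarith) (by linarith), rotation_coe,
    swap_outside_neg (by linarith) (by linarith), rotation_coe, neg_add_cancel_right,
    swap_outside_neg (by linarith) (by linarith)]

theorem smallSwap_left_of_one {δ u : ℝ} (h0 : 0 < δ) (h1 : δ < 1 / 4)
    (hu : 1 - δ ≤ u) (hu' : u < 1) :
    (smallSwap δ).1 (onCircle (u : AddCircle (2 : ℝ))) =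
      onCircle ((u + δ : ℝ) : AddCircle (2 : ℝ)) := by
  rw [smallSwap_apply, rotation_coe, swap_outside (by linarith) (by linarith), rotation_coe,
    add_neg_cancel_right, rotation_swap_coe _ (by linarith) hu', swap_swap, rotation_coe,
    swap_outside (by linarith) (by linarith)]

theorem smallSwap_right_of_one {δ u : ℝ} (h0 : 0 < δ) (h1 : δ < 1 / 4)
    (hu : 1 ≤ u) (hu' : u < 1 + δ) :
    (smallSwap δ).1 (onCircle (u : AddCircle (2 : ℝ))) =
      onCircle ((u - δ : ℝ) : AddCircle (2 : ℝ)) := by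
  rw [smallSwap_apply, rotation_coe, swap_outside (by linarith) (by linarith), rotation_coe,
    add_neg_cancel_right, swap_outside hu (by linarith), rotation_coe, ← sub_eq_add_neg,
    rotation_swap_coe _ (by linarith) (by linarith), swap_swap]

theorem smallSwap_eq_self_of_arc {δ u : ℝ} (h0 : 0 < δ)
    (hu : 0 ≤ u) (hu' : u < 1 - δ) :
    (smallSwap δ).1 (onCircle (u : AddCircle (2 : ℝ))) = onCircle (u : AddCircle (2 : ℝ)) := by
  rw [smallSwap_apply, rotation_coe, rotation_swap_coe _ (by linarith) (by linarith), swap_swap,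
    rotation_coe, add_neg_cancel_right, rotation_swap_coe _ hu (by linarith), swap_swap]

theorem smallSwap_eq_self_of_outside {δ u : ℝ} (h0 : 0 < δ)
    (hu : 1 + δ ≤ u) (hu' : u < 2 - δ) :
    (smallSwap δ).1 (onCircle (u : AddCircle (2 : ℝ))) = onCircle (u : AddCircle (2 : ℝ)) := by
  rw [smallSwap_apply, rotation_coe, swap_outside (by linarith) (by linarith), rotation_coe,
    add_neg_cancel_right, swap_outside (by linarith) (by linarith), rotation_coe,
    swap_outside (by linarith) (by linarith), rotation_coe, neg_add_cancel_right,
    swap_outside (by linarith) (by linarith)]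

theorem smallSwap_eq_self_of_interval {δ u : ℝ} (h0 : 0 < δ)
    (hu : δ ≤ u) (hu' : u < 1) :
    (smallSwap δ).1 (swap.1 (onCircle (u : AddCircle (2 : ℝ)))) =
      swap.1 (onCircle (u : AddCircle (2 : ℝ))) := by
  rw [smallSwap_apply, rotation_swap_coe _ (by linarith) hu', swap_swap, rotation_coe,
    rotation_swap_coe _ (by linarith) (by linarith), swap_swap, rotation_coe,
    neg_add_cancel_right]

/-! ### Slots permuted by conjugates of the small swap -/

theorem exists_coe_eq (a : ℝ) (c : AddCircle (2 : ℝ)) :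
    ∃ u : ℝ, a ≤ u ∧ u < a + 2 ∧ (u : AddCircle (2 : ℝ)) = c :=
  ⟨AddCircle.equivIco 2 a c, (AddCircle.equivIco 2 a c).2.1, (AddCircle.equivIco 2 a c).2.2,
    AddCircle.coe_equivIco⟩

/-- The index set of the intervals moved by conjugates of a small swap: `none` stands for the
interval `[0, δ)`, `some i` for `[-δ, 0)` moved by `3 i δ`, and `(i, false)` and `(i, true)` for
`[1 - δ, 1)` and `[1, 1 + δ)` moved by `3 i δ`. -/
noncomputable def slot (δ : ℝ) {n : ℕ} : Option (Fin n) ⊕ Fin n × Bool → ℝ →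
    circleIntervalDomain.Point
  | Sum.inl none, u => swap.1 (onCircle (u : AddCircle (2 : ℝ)))
  | Sum.inl (some i), u => onCircle (((3 * i - 1 : ℤ) * δ + u : ℝ) : AddCircle (2 : ℝ))
  | Sum.inr (i, false), u => onCircle ((1 + ((3 * i - 1 : ℤ) * δ + u) : ℝ) : AddCircle (2 : ℝ))
  | Sum.inr (i, true), u => onCircle ((1 + ((3 * i : ℤ) * δ + u) : ℝ) : AddCircle (2 : ℝ))

/-- The conjugate of a small swap by the rotation of angle `3 i δ`. -/
noncomputable def movedSwap (δ : ℝ) (i : ℕ) : IET circleIntervalDomain :=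
  rotation (3 * i * δ) * smallSwap δ * rotation (-(3 * i * δ))

theorem movedSwap_apply (δ : ℝ) (i : ℕ) (x : circleIntervalDomain.Point) :
    (movedSwap δ i).1 x =
      (rotation (3 * i * δ)).1 ((smallSwap δ).1 ((rotation (-(3 * i * δ))).1 x)) := rfl

theorem rotation_rotation_neg (t : ℝ) (x : circleIntervalDomain.Point) :
    (rotation t).1 ((rotation (-t)).1 x) = x := by
  have : rotation t * rotation (-t) = 1 := by
    rw [← rotation_add, add_neg_cancel, rotation_zero]
  exact congrArg (fun g : IET circleIntervalDomain => g.1 x) this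

/-- The slot `none` lies in the interval, which rotations fix, so it is the letter shared by all the
conjugates. -/
theorem movedSwap_slot {δ : ℝ} (h0 : 0 < δ) (h1 : δ < 1 / 4) {n : ℕ} (i : Fin n) {u : ℝ}
    (hu : 0 ≤ u) (hu' : u < δ) :
    (movedSwap δ i).1 (slot δ (Sum.inl none : Option (Fin n) ⊕ Fin n × Bool) u) =
      slot δ (Sum.inl (some i)) u ∧
    (movedSwap δ i).1 (slot δ (Sum.inl (some i)) u) =
      slot δ (Sum.inl none : Option (Fin n) ⊕ Fin n × Bool) u ∧
    (movedSwap δ i).1 (slot δ (Sum.inr (i, false)) u) = slot δ (Sum.inr (i, true)) u ∧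
    (movedSwap δ i).1 (slot δ (Sum.inr (i, true)) u) = slot δ (Sum.inr (i, false)) u := by
  refine ⟨?_, ?_, ?_, ?_⟩
  · rw [slot, slot, movedSwap_apply, rotation_swap_coe _ hu (by linarith),
      smallSwap_interval_start h0 h1 hu hu', rotation_coe]
    congr 2; push_cast; ring
  · rw [slot, slot, movedSwap_apply, rotation_coe, show ((3 * i - 1 : ℤ) * δ + u + -(3 * i * δ) : ℝ)
        = u - δ by push_cast; ring, smallSwap_left_of_zero h0 h1 (by linarith) (by linarith),
      sub_add_cancel, rotation_swap_coe _ hu (by linarith)]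
  · rw [slot, slot, movedSwap_apply, rotation_coe,
      show (1 + ((3 * i - 1 : ℤ) * δ + u) + -(3 * i * δ) : ℝ) = 1 + u - δ by push_cast; ring,
      smallSwap_left_of_one h0 h1 (by linarith) (by linarith), rotation_coe]
    congr 2; push_cast; ring
  · rw [slot, slot, movedSwap_apply, rotation_coe,
      show (1 + ((3 * i : ℤ) * δ + u) + -(3 * i * δ) : ℝ) = 1 + u by push_cast; ring,
      smallSwap_right_of_one h0 h1 (by linarith) (by linarith), rotation_coe]
    congr 2; push_cast; ring

theorem movedSwap_eq_self_or {δ : ℝ} (h0 : 0 < δ) {n : ℕ} (i : Fin n)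
    (x : circleIntervalDomain.Point) : (movedSwap δ i).1 x = x ∨ ∃ u, 0 ≤ u ∧ u < δ ∧
      (x = slot δ (Sum.inl none : Option (Fin n) ⊕ Fin n × Bool) u ∨
        x = slot δ (Sum.inl (some i)) u ∨ x = slot δ (Sum.inr (i, false)) u ∨
        x = slot δ (Sum.inr (i, true)) u) := by
  obtain ⟨y, rfl⟩ : ∃ y, x = (rotation (3 * i * δ)).1 y :=
    ⟨_, (rotation_rotation_neg (3 * i * δ) x).symm⟩
  have hy : (rotation (-(3 * i * δ))).1 ((rotation (3 * i * δ)).1 y) = y := by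
    simpa using rotation_rotation_neg (-(3 * i * δ)) y
  rw [movedSwap_apply, hy]
  revert y
  have key : ∀ y : circleIntervalDomain.Point, (smallSwap δ).1 y = y ∨ ∃ u, 0 ≤ u ∧ u < δ ∧
      ((rotation (3 * i * δ)).1 y = slot δ (Sum.inl none : Option (Fin n) ⊕ Fin n × Bool) u ∨
        (rotation (3 * i * δ)).1 y = slot δ (Sum.inl (some i)) u ∨
        (rotation (3 * i * δ)).1 y = slot δ (Sum.inr (i, false)) u ∨
        (rotation (3 * i * δ)).1 y = slot δ (Sum.inr (i, true)) u) := by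
    refine cases (fun c => ?_) fun x => ?_
    · obtain ⟨u, hu, hu', rfl⟩ := exists_coe_eq (-δ) c
      rcases lt_or_ge u 0 with h | h
      · refine Or.inr ⟨u + δ, by linarith, by linarith, Or.inr (Or.inl ?_)⟩
        rw [rotation_coe, slot]
        congr 2; push_cast; ring
      rcases lt_or_ge u (1 - δ) with h2 | h2
      · exact Or.inl (smallSwap_eq_self_of_arc h0 h h2)
      rcases lt_or_ge u 1 with h3 | h3
      · refine Or.inr ⟨u - 1 + δ, by linarith, by linarith, Or.inr (Or.inr (Or.inl ?_))⟩
        rw [rotation_coe, slot]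
        congr 2; push_cast; ring
      rcases lt_or_ge u (1 + δ) with h4 | h4
      · refine Or.inr ⟨u - 1, by linarith, by linarith, Or.inr (Or.inr (Or.inr ?_))⟩
        rw [rotation_coe, slot]
        congr 2; push_cast; ring
      · exact Or.inl (smallSwap_eq_self_of_outside h0 h4 (by linarith))
    · obtain ⟨u, hu, hu'⟩ := x
      rw [← swap_arc hu hu']
      rcases lt_or_ge u δ with h | h
      · exact Or.inr ⟨u, hu, h, Or.inl (rotation_swap_coe _ hu hu')⟩
      · exact Or.inl (smallSwap_eq_self_of_interval h0 h hu')
  intro y _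
  exact (key y).imp_left fun h => by rw [h]

theorem eq_of_mul_add_eq {δ : ℝ} (h0 : 0 < δ) {a b : ℤ} {u v : ℝ} (hu : 0 ≤ u) (hu' : u < δ)
    (hv : 0 ≤ v) (hv' : v < δ) (h : a * δ + u = b * δ + v) : a = b ∧ u = v := by
  have hab : a = b := by
    have h1 : (a : ℝ) < b + 1 := by
      by_contra! hc
      nlinarith
    have h2 : (b : ℝ) < a + 1 := by
      by_contra! hc
      nlinarith
    have h1' : a < b + 1 := by exact_mod_cast h1
    have h2' : b < a + 1 := by exact_mod_cast h2
    omega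
  exact ⟨hab, by rw [hab] at h; linarith⟩

theorem onCircle_coe_inj {a u v : ℝ} (hu : a ≤ u) (hu' : u < a + 2) (hv : a ≤ v)
    (hv' : v < a + 2) (h : onCircle (u : AddCircle (2 : ℝ)) = onCircle (v : AddCircle (2 : ℝ))) :
    u = v :=
  (AddCircle.coe_eq_coe_iff_of_mem_Ico (p := (2 : ℝ)) ⟨hu, hu'⟩ ⟨hv, hv'⟩).1 (Sum.inl_injective h)

theorem swap_ne_onCircle {u : ℝ} (h0 : 0 ≤ u) (h1 : u < 1) (c : AddCircle (2 : ℝ)) :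
    swap.1 (onCircle (u : AddCircle (2 : ℝ))) ≠ onCircle c := by
  rw [swap_arc h0 h1]
  exact Sum.inr_ne_inl

/-- The bound on `δ` keeps the arcs near `0` apart from those near `1`. Inside each family the
starting points are distinct multiples of `δ`, the spacing `3` leaving room for both arcs of a pair.
-/
theorem slot_injective {δ : ℝ} (h0 : 0 < δ) {n : ℕ} (h1 : (3 * n + 3) * δ < 1 / 2) :
    Function.Injective fun x : (Option (Fin n) ⊕ Fin n × Bool) × Set.Ico 0 δ =>
      slot δ x.1 x.2.1 := by
  have hδ : δ < 1 / 4 := by nlinarith [(Nat.cast_nonneg n : (0 : ℝ) ≤ n)]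
  have hb : ∀ i : Fin n, 0 ≤ (i : ℝ) * δ ∧ 3 * ((i : ℝ) * δ) + 6 * δ < 1 / 2 + 3 * δ := by
    intro i
    have hi : (i : ℝ) + 1 ≤ n := by exact_mod_cast i.2
    exact ⟨by positivity, by nlinarith⟩
  rintro ⟨j, u, hu, hu'⟩ ⟨k, v, hv, hv'⟩ h
  simp only at h
  rcases j with (_ | i) | ⟨i, _ | _⟩ <;> rcases k with (_ | k) | ⟨k, _ | _⟩ <;>
    simp only [slot] at h
  case inl.none.inl.none =>
    rw [swap.1.injective.eq_iff] at h
    obtain rfl := onCircle_coe_inj (a := 0) hu (by linarith) hv (by linarith) h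
    rfl
  case inl.none.inl.some => exact absurd h (swap_ne_onCircle hu (by linarith) _)
  case inl.none.inr.false => exact absurd h (swap_ne_onCircle hu (by linarith) _)
  case inl.none.inr.true => exact absurd h (swap_ne_onCircle hu (by linarith) _)
  case inl.some.inl.none => exact absurd h.symm (swap_ne_onCircle hv (by linarith) _)
  case inr.false.inl.none => exact absurd h.symm (swap_ne_onCircle hv (by linarith) _)
  case inr.true.inl.none => exact absurd h.symm (swap_ne_onCircle hv (by linarith) _)
  all_goals
    have hbi := hb i
    have hbk := hb k
    -- The leftmost arc starts at `-δ`, so all coordinates lie in the fundamental domain `[-δ, 2 -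
    -- δ)`.
    replace h := onCircle_coe_inj (a := -δ) (by push_cast; linarith) (by push_cast; linarith)
      (by push_cast; linarith) (by push_cast; linarith) h
  case inl.some.inr.false => push_cast at h; linarith
  case inl.some.inr.true => push_cast at h; linarith
  case inr.false.inl.some => push_cast at h; linarith
  case inr.true.inl.some => push_cast at h; linarith
  case inl.some.inl.some =>
    obtain ⟨h2, rfl⟩ := eq_of_mul_add_eq h0 hu hu' hv hv' h
    obtain rfl : i = k := Fin.ext (by omega)
    rfl
  all_goals obtain ⟨h2, rfl⟩ := eq_of_mul_add_eq h0 hu hu' hv hv' (add_left_cancel h)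
  case inr.false.inr.true => omega
  case inr.true.inr.false => omega
  all_goals
    obtain rfl : i = k := Fin.ext (by omega)
    rfl

/-- The embedding of the slots into the domain. -/
noncomputable def slotEmbedding {δ : ℝ} (h0 : 0 < δ) {n : ℕ} (h1 : (3 * n + 3) * δ < 1 / 2) :
    (Option (Fin n) ⊕ Fin n × Bool) × Set.Ico 0 δ ↪ circleIntervalDomain.Point :=
  ⟨_, slot_injective h0 h1⟩

/-- A permutation of the slots, as a permutation of the domain. -/
noncomputable def slotPermHom {δ : ℝ} (h0 : 0 < δ) {n : ℕ} (h1 : (3 * n + 3) * δ < 1 / 2) :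
    Equiv.Perm (Option (Fin n) ⊕ Fin n × Bool) →* Equiv.Perm circleIntervalDomain.Point :=
  (Equiv.Perm.viaEmbeddingHom (slotEmbedding h0 h1)).comp
    { toFun g := Equiv.prodCongr g (Equiv.refl _)
      map_one' := rfl
      map_mul' _ _ := rfl }

theorem slotPermHom_injective {δ : ℝ} (h0 : 0 < δ) {n : ℕ} (h1 : (3 * n + 3) * δ < 1 / 2) :
    Function.Injective (slotPermHom h0 h1) := by
  refine (Equiv.Perm.viaEmbeddingHom_injective _).comp fun g h hgh => Equiv.ext fun j => ?_
  exact congrArg Prod.fst (Equiv.congr_fun hgh (j, ⟨0, le_rfl, h0⟩))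

/-- Both sides agree on the four slots involved, and neither moves anything else: the support of the
moved swap lies in those slots, which are disjoint from the others. -/
theorem slotPermHom_starPerm {δ : ℝ} (h0 : 0 < δ) {n : ℕ} (h1 : (3 * n + 3) * δ < 1 / 2)
    (i : Fin n) : slotPermHom h0 h1 (starPerm i) = (movedSwap δ i).1 := by
  have hδ : δ < 1 / 4 := by nlinarith [(Nat.cast_nonneg n : (0 : ℝ) ≤ n)]
  refine Equiv.ext fun x => ?_
  change Equiv.Perm.viaEmbedding (Equiv.prodCongr (starPerm i) (Equiv.refl _))
    (slotEmbedding h0 h1) x = _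
  by_cases hx : x ∈ Set.range (slotEmbedding h0 h1)
  · obtain ⟨⟨j, u, hu, hu'⟩, rfl⟩ := hx
    rw [Equiv.Perm.viaEmbedding_apply]
    change slot δ (starPerm i j) u = (movedSwap δ i).1 (slot δ j u)
    obtain ⟨e1, e2, e3, e4⟩ := movedSwap_slot h0 hδ i hu hu'
    by_cases hj : j = Sum.inl none ∨ j = Sum.inl (some i) ∨ j = Sum.inr (i, false) ∨
        j = Sum.inr (i, true)
    · rcases hj with rfl | rfl | rfl | rfl
      · rw [e1]; simp [starPerm]
      · rw [e2]; simp [starPerm]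
      · rw [e3]; simp [starPerm]
      · rw [e4]; simp [starPerm]
    · push Not at hj
      obtain ⟨n1, n2, n3, n4⟩ := hj
      have hs : starPerm i j = j := by
        rcases j with j | j
        · have a1 : j ≠ none := fun h => n1 (by rw [h])
          have a2 : j ≠ some i := fun h => n2 (by rw [h])
          simp [starPerm, Equiv.swap_apply_of_ne_of_ne a1 a2]
        · have a1 : j ≠ (i, false) := fun h => n3 (by rw [h])
          have a2 : j ≠ (i, true) := fun h => n4 (by rw [h])
          simp [starPerm, Equiv.swap_apply_of_ne_of_ne a1 a2]
      rw [hs]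
      have hinj : ∀ (k : Option (Fin n) ⊕ Fin n × Bool) (v : ℝ), 0 ≤ v → v < δ →
          slot δ j u = slot δ k v → j = k := fun k v hv hv' h =>
        congrArg Prod.fst (slot_injective h0 h1 (a₁ := (j, ⟨u, hu, hu'⟩)) (a₂ := (k, ⟨v, hv, hv'⟩)) h)
      rcases movedSwap_eq_self_or h0 i (slot δ j u) with h | ⟨v, hv, hv', h | h | h | h⟩
      · exact h.symm
      exacts [absurd (hinj _ v hv hv' h) n1, absurd (hinj _ v hv hv' h) n2,
        absurd (hinj _ v hv hv' h) n3, absurd (hinj _ v hv hv' h) n4]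
  · rw [Equiv.Perm.viaEmbedding_apply_of_notMem _ _ _ hx]
    rcases movedSwap_eq_self_or h0 i x with h | ⟨v, hv, hv', h | h | h | h⟩
    · exact h.symm
    exacts [absurd ⟨(Sum.inl none, ⟨v, hv, hv'⟩), h.symm⟩ hx,
      absurd ⟨(Sum.inl (some i), ⟨v, hv, hv'⟩), h.symm⟩ hx,
      absurd ⟨(Sum.inr (i, false), ⟨v, hv, hv'⟩), h.symm⟩ hx,
      absurd ⟨(Sum.inr (i, true), ⟨v, hv, hv'⟩), h.symm⟩ hx]

/-- A group of interval exchanges containing an irrational rotation and the swap contains every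
finite group. -/
theorem exists_hom_of_finite {θ : ℝ} (hθ : Irrational θ)
    {F : Subgroup (IET circleIntervalDomain)} (hr : rotation θ ∈ F) (hs : swap ∈ F)
    (H : Type u) [Group H] [Finite H] : ∃ ι : H →* F, Function.Injective ι := by
  obtain ⟨n, ι, hι, hmem⟩ := exists_hom_closure_starPerm H
  obtain ⟨δ, hδ, h0, h1⟩ := exists_small_rotation hθ hr
    (show (0 : ℝ) < 1 / 2 / (3 * n + 3) by positivity)
  rw [lt_div_iff₀' (by positivity)] at h1
  have hδ' : -δ ∈ rotationAngles F := (rotationAngles F).neg_mem hδ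
  have hsmall : smallSwap δ ∈ F := F.mul_mem (F.mul_mem (F.mul_mem (F.mul_mem (F.mul_mem
    (F.mul_mem (F.mul_mem hs hδ) hs) hδ') hs) hδ') hs) hδ
  have hmoved : ∀ i : ℕ, movedSwap δ i ∈ F := by
    intro i
    have h3 : 3 * i * δ ∈ rotationAngles F := by
      have := (rotationAngles F).nsmul_mem hδ (3 * i)
      rwa [nsmul_eq_mul, Nat.cast_mul, Nat.cast_ofNat] at this
    exact F.mul_mem (F.mul_mem h3 hsmall) ((rotationAngles F).neg_mem h3)
  -- Slot permutations act as bare permutations of points; membership in this image is what shows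
  -- that those used are interval exchanges in `F`.
  let F' := F.map (IET circleIntervalDomain).subtype
  have hle : Subgroup.closure (Set.range (starPerm (κ := Fin n))) ≤ F'.comap (slotPermHom h0 h1) := by
    rw [Subgroup.closure_le]
    rintro _ ⟨i, rfl⟩
    exact ⟨movedSwap δ i, hmoved i, (slotPermHom_starPerm h0 h1 i).symm⟩
  let e : F ≃* F' := F.equivMapOfInjective _ (IET circleIntervalDomain).subtype_injective
  refine ⟨e.symm.toMonoidHom.comp
    (((slotPermHom h0 h1).comp ι).codRestrict F' fun h => hle (hmem h)), ?_⟩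
  refine e.symm.injective.comp fun g h hgh => hι (slotPermHom_injective h0 h1 ?_)
  exact congrArg Subtype.val hgh

end circleIntervalDomain

/-! ### Assembly on the unit interval -/

open circleIntervalDomain in
theorem fg_closure_rotation_swap (θ : ℝ) :
    Group.FG (Subgroup.closure {rotation θ, swap} : Subgroup (IET circleIntervalDomain)) := by
  have : Finite ({rotation θ, swap} : Set (IET circleIntervalDomain)) :=
    (Set.toFinite {rotation θ, swap}).to_subtype
  exact Group.closure_finite_fg _

theorem mainTheorem4 (θ : ℝ) (hθ : Irrational θ) :
    ∃ (φ : circleIntervalDomain.Point ≃ unitIntervalDomain.Point)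
      (Φ : IET circleIntervalDomain ≃* IET unitIntervalDomain)
      (F : Subgroup (IET unitIntervalDomain)),
      (∀ (g : IET circleIntervalDomain) (x : circleIntervalDomain.Point),
        (Φ g).1 (φ x) = φ (g.1 x)) ∧
      F = Subgroup.closure
        {Φ (circleIntervalDomain.rotation θ), Φ circleIntervalDomain.swap} ∧
      (∀ (H : Type u) [Group H] [Finite H], ∃ ι : H →* F, Function.Injective ι) ∧
      (∃ ι : FreeSemigroup (Fin 2) →ₙ* F, Function.Injective ι) ∧
      ¬ IsLinearGroup.{v} F ∧
      HasExponentialGrowth F := by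
  set φ := unroll.trans divThree
  let Φ := IET.congr φ permCongr_unroll_divThree_mem_iff
  set F₀ := Subgroup.closure {circleIntervalDomain.rotation θ, circleIntervalDomain.swap} with hF₀
  let e : F₀ ≃* F₀.map Φ.toMonoidHom := Φ.subgroupMap F₀
  have hr : circleIntervalDomain.rotation θ ∈ F₀ := Subgroup.subset_closure (Or.inl rfl)
  have hs : circleIntervalDomain.swap ∈ F₀ := Subgroup.subset_closure (Or.inr rfl)
  have hfin : ∀ (H : Type u) [Group H] [Finite H],
      ∃ ι : H →* F₀.map Φ.toMonoidHom, Function.Injective ι := by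
    intro H _ _
    obtain ⟨ι, hι⟩ := circleIntervalDomain.exists_hom_of_finite hθ hr hs H
    exact ⟨e.toMonoidHom.comp ι, e.injective.comp hι⟩
  -- The nonlinearity argument uses finite groups in the lowest universe, independently of `u`.
  have hfin₀ : ∀ (H : Type) [Group H] [Finite H],
      ∃ ι : H →* F₀.map Φ.toMonoidHom, Function.Injective ι := by
    intro H _ _
    obtain ⟨ι, hι⟩ := circleIntervalDomain.exists_hom_of_finite hθ hr hs H
    exact ⟨e.toMonoidHom.comp ι, e.injective.comp hι⟩
  obtain ⟨ι, hι⟩ := circleIntervalDomain.exists_freeSemigroup_closure hθ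
  let κ : FreeSemigroup (Fin 2) →ₙ* F₀.map Φ.toMonoidHom := e.toMulHom.comp ι
  have hκ : Function.Injective κ := e.injective.comp hι
  have hfg : Group.FG (F₀.map Φ.toMonoidHom) := by
    have := fg_closure_rotation_swap θ
    exact Group.fg_of_surjective (f := e.toMonoidHom) e.surjective
  refine ⟨φ, Φ, F₀.map Φ.toMonoidHom, fun g x => ?_, ?_, hfin, ⟨κ, hκ⟩,
    not_isLinearGroup_of_finite_embed hfin₀, hasExponentialGrowth_of_freeSemigroup hfg κ hκ⟩
  · exact congrArg (fun y => φ (g.1 y)) (φ.symm_apply_apply x)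
  · rw [hF₀, MonoidHom.map_closure, Set.image_pair]
    rfl
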